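/- Let $A=(a_{ij})_{i,j\in I}$ be a symmetrizable generalized Cartan matrix with realization $(\mathfrak h,\{\alpha_i\},\{\alpha_i^\vee\})$, $\dim\mathfrak h=2|I|-\operatorname{rank}A$, and let $\mathfrak g$ be its Kac--Moody algebra over $\mathbb C$, generated by $\mathfrak h$, $e_i$, $f_i$ with the relations $[h,h']=0$, $[h,e_i]=\alpha_i(h)e_i$, $[h,f_i]=-\alpha_i(h)f_i$, $[e_i,f_j]=\delta_{ij}\alpha_i^\vee$ and, for $i\neq j$, $(\operatorname{ad}e_i)^{1-a_{ij}}e_j=(\operatorname{ad}f_i)^{1-a_{ij}}f_j=0$. Let $\Delta$, $\Delta^+$, $\Delta^-$ be its sets of roots, positive roots and negative roots, and let $P\subset\mathfrak h^*$ be a restricted weight lattice, that is, a subgroup containing all $\alpha_i$, with integral values on all $\alpha_i^\vee$, which has a $\mathbb Z$-basis that is also a $\mathbb C$-basis of $\mathfrak h^*$ and contains elements $\omega_i$ with $\omega_i(\alpha_j^\vee)=\delta_{ij}$. Let $(V,\rho)$ be a standard graded $\mathfrak g$-module: $V$ is the direct sum of its weight spaces $V_\mu$, these are finite dimensional, all weights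 lie in $P$, and there is a $\mathbb Z$-linear map $f:P\to\mathbb Z$ such that, for each $m\in\mathbb Z$, the sets $\Delta_m=\{\gamma\in\Delta\cup\{0\}: f(\gamma)=m\}$ and $\mathrm{wts}_m=\{\mu\in\mathrm{wts}(V): f(\mu)=m\}$ are finite; $\Delta_m\subseteq\Delta^+$ for $m>0$, $\Delta_0=\{0\}$, $\Delta_m\subseteq\Delta^-$ for $m<0$; and distinct elements of $\mathrm{wts}_m$ never differ by a sum of simple roots. Put $\mathfrak g_m=\bigoplus_{\gamma\in\Delta_m}\mathfrak g_\gamma$, $V_m=\bigoplus_{\mu\in\mathrm{wts}_m}V_\mu$ and $\widehat V=\bigoplus_{m<0}V_m\oplus\prod_{m\ge0}V_m$. For $x\in\mathfrak g_k$ with $k>0$, $\rho(x)$ acts on $\widehat V$ by $(\rho(x)v)_m=x\cdot v_{m-k}$, and $\exp(\rho(x))=\sum_n\rho(x)^n/n!\in GL(\widehat V)$, where each component of $\exp(\rho(x))v$ is a finite sum. Infinite products in $GL(\widehat V)$ over a totally ordered index set are read from right to left in the order of the indices, and are the limits of the products over finite sets of indices: each component of the image of each vector is eventually constant. Let $\widehat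 U^+_{V,1}\subseteq GL(\widehat V)$ be the set of all products $\prod_{k=1}^\infty\exp(\rho(x_k))$ with $x_k\in\mathfrak g_k$. Write $(a,b)=aba^{-1}b^{-1}$. For $\alpha,\beta\in\Delta^+$, let $\Sigma(\alpha,\beta)=\bigcup_{n\ge1}\Sigma_n$, where $\Sigma_1=\{\alpha+\beta\}\cap\Delta$ and $\Sigma_n=\{\gamma+\alpha,\gamma+\beta:\gamma\in\Sigma_{n-1}\}\cap\Delta$, and let $J$ be the set of pairs $(i,j)$ of positive integers with $i\alpha+j\beta\in\Sigma(\alpha,\beta)$. (If $\alpha,\beta$ are linearly independent, then $(i,j)\mapsto i\alpha+j\beta$ is a bijection from $J$ onto $\Sigma(\alpha,\beta)$.) Fix any total order on $J$. **Proposition.** Let $\alpha,\beta\in\Delta^+$, $x_\alpha\in\mathfrak g_\alpha$, $y_\beta\in\mathfrak g_\beta$. 1. There are elements $z_{ij}\in\mathfrak g_{i\alpha+j\beta}$, $(i,j)\in J$, such that $$\bigl(\exp(u\rho(x_\alpha)),\exp(v\rho(y_\beta))\bigr)=\prod_{(i,j)\in J}\exp\bigl(u^iv^j\rho(z_{ij})\bigr)\qquad\text{for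 all }u,v\in\mathbb C,$$ with $z_{11}=[x_\alpha,y_\beta]$ if $(1,1)\in J$. The operators $\rho(z_{ij})$ on $V$ are uniquely determined by this formula. 2. If no nonzero element of a root space $\mathfrak g_\gamma$, $\gamma\in\Delta^+$, acts as zero on $V$ (in particular, if $V$ is faithful), then the elements $z_{ij}$ themselves are uniquely determined by this formula. 3. For all $u,v\in\mathbb C$, the commutator in the formula belongs to $\widehat U^+_{V,1}$. -/

import Mathlib

open Module

noncomputable section

namespace KM

/-! ### Generalized Cartan matrices, realizations, Kac–Moody algebras -/

/-- Generalized Cartan matrices. -/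
structure IsGCM {ι : Type*} (A : Matrix ι ι ℤ) : Prop where
  diag : ∀ i, A i i = 2
  offDiag : ∀ i j, i ≠ j → A i j ≤ 0
  zero_symm : ∀ i j, A i j = 0 → A j i = 0

/-- `A` is symmetrizable: `diag(d) A` is symmetric for some positive rational numbers `d i`. -/
def IsSymmetrizable {ι : Type*} [Fintype ι] [DecidableEq ι] (A : Matrix ι ι ℤ) : Prop :=
  ∃ d : ι → ℚ, (∀ i, 0 < d i) ∧ (Matrix.diagonal d * A.map (Int.cast : ℤ → ℚ)).IsSymm

/-- A realization `(𝔥, Π, Π^∨)` of `A`. -/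
structure Realization {ι : Type*} [Fintype ι] (A : Matrix ι ι ℤ)
    (H : Type*) [AddCommGroup H] [Module ℂ H] where
  finDim : FiniteDimensional ℂ H
  /-- `dim 𝔥 = 2ℓ - rank A`. -/
  finrank_add_rank :
    finrank ℂ H + (A.map (Int.cast : ℤ → ℂ)).rank = 2 * Fintype.card ι
  /-- The simple roots. -/
  root : ι → Dual ℂ H
  /-- The simple coroots. -/
  coroot : ι → H
  root_linearIndependent : LinearIndependent ℂ root
  coroot_linearIndependent : LinearIndependent ℂ coroot
  root_coroot : ∀ i j, root j (coroot i) = (A i j : ℂ)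

/-- The generating set `𝔥 ∪ {e_i, f_i}` of the Kac–Moody algebra. -/
inductive Gen (ι H : Type*)
  | h : H → Gen ι H
  | e : ι → Gen ι H
  | f : ι → Gen ι H

section algebra

variable {ι : Type*} [Fintype ι] {A : Matrix ι ι ℤ}
  {H : Type*} [AddCommGroup H] [Module ℂ H]

/-- The free Lie algebra on the generating set. -/
abbrev FreeGen (ι H : Type*) := FreeLieAlgebra ℂ (Gen ι H)

/-- The generator of the free Lie algebra given by `h ∈ 𝔥`. -/
abbrev genH (ι : Type*) {H : Type*} (h : H) : FreeGen ι H := FreeLieAlgebra.of ℂ (Gen.h h)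

/-- The generator `e_i` of the free Lie algebra. -/
abbrev genE {ι : Type*} (H : Type*) (i : ι) : FreeGen ι H := FreeLieAlgebra.of ℂ (Gen.e i)

/-- The generator `f_i` of the free Lie algebra. -/
abbrev genF {ι : Type*} (H : Type*) (i : ι) : FreeGen ι H := FreeLieAlgebra.of ℂ (Gen.f i)

/-- The elements of the free Lie algebra that are set to zero in the Kac–Moody algebra. The first
two kinds say that `𝔥` enters with its vector space structure. -/
inductive Relator (R : Realization A H) : FreeGen ι H → Prop
  | h_add (h h' : H) : Relator R (genH ι (h + h') - genH ι h - genH ι h')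
  | h_smul (c : ℂ) (h : H) : Relator R (genH ι (c • h) - c • genH ι h)
  | hh (h h' : H) : Relator R ⁅genH ι h, genH ι h'⁆
  | he (h : H) (i : ι) : Relator R (⁅genH ι h, genE H i⁆ - R.root i h • genE H i)
  | hf (h : H) (i : ι) : Relator R (⁅genH ι h, genF H i⁆ + R.root i h • genF H i)
  | ef_self (i : ι) : Relator R (⁅genE H i, genF H i⁆ - genH ι (R.coroot i))
  | ef_ne (i j : ι) (hij : i ≠ j) : Relator R ⁅genE H i, genF H j⁆
  | ad_e (i j : ι) (hij : i ≠ j) : Relator R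
      (((LieAlgebra.ad ℂ (FreeGen ι H) (genE H i)) ^ (1 - A i j).toNat) (genE H j))
  | ad_f (i j : ι) (hij : i ≠ j) : Relator R
      (((LieAlgebra.ad ℂ (FreeGen ι H) (genF H i)) ^ (1 - A i j).toNat) (genF H j))

/-- The ideal generated by the defining relations. -/
def relIdeal (R : Realization A H) : LieIdeal ℂ (FreeGen ι H) :=
  LieSubmodule.lieSpan ℂ (FreeGen ι H) {x | Relator R x}

/-- The Kac–Moody algebra `𝔤(A)` of a realization of `A`, by generators and relations. -/
def Alg (R : Realization A H) : Type _ := FreeGen ι H ⧸ relIdeal R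

instance (R : Realization A H) : LieRing (Alg R) :=
  inferInstanceAs (LieRing (FreeGen ι H ⧸ relIdeal R))

instance (R : Realization A H) : LieAlgebra ℂ (Alg R) :=
  inferInstanceAs (LieAlgebra ℂ (FreeGen ι H ⧸ relIdeal R))

/-- The image in `𝔤` of an element of `𝔥`. -/
def ofH (R : Realization A H) (h : H) : Alg R :=
  LieSubmodule.Quotient.mk (N := relIdeal R) (genH ι h)

/-! ### Roots -/

/-- `𝔤_γ = {x | [h, x] = γ(h) x for all h ∈ 𝔥}`. -/
def rootSpace (R : Realization A H) (γ : Dual ℂ H) : Submodule ℂ (Alg R) where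
  carrier := {x | ∀ h : H, ⁅ofH R h, x⁆ = γ h • x}
  add_mem' := by
    intro x y hx hy h
    rw [lie_add, hx h, hy h, smul_add]
  zero_mem' := by
    intro h
    simp
  smul_mem' := by
    intro c x hx h
    rw [lie_smul, hx h, smul_comm]

/-- The set `Δ` of roots. -/
def roots (R : Realization A H) : Set (Dual ℂ H) := {γ | γ ≠ 0 ∧ rootSpace R γ ≠ ⊥}

/-- `Q^+`, the set of sums of simple roots. -/
def posCone (R : Realization A H) : Set (Dual ℂ H) :=
  {γ | ∃ k : ι → ℕ, γ = ∑ i, k i • R.root i}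

/-- The set `Δ^+` of positive roots. -/
def posRoots (R : Realization A H) : Set (Dual ℂ H) := {γ | γ ∈ roots R ∧ γ ∈ posCone R}

/-- The set `Δ^-` of negative roots. -/
def negRoots (R : Realization A H) : Set (Dual ℂ H) := {γ | γ ∈ roots R ∧ -γ ∈ posCone R}

/-- The sets `Σ_{n+1}` in the definition of the root span of `α` and `β`. -/
def rootSpanStep (R : Realization A H) (α β : Dual ℂ H) : ℕ → Set (Dual ℂ H)
  | 0 => {α + β} ∩ roots R
  | n + 1 => {δ | ∃ γ ∈ rootSpanStep R α β n, δ = γ + α ∨ δ = γ + β} ∩ roots R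

/-- The root span `Σ(α, β)`. -/
def rootSpan (R : Realization A H) (α β : Dual ℂ H) : Set (Dual ℂ H) :=
  ⋃ n, rootSpanStep R α β n

/-- The index set of the product in the commutator formula: pairs `(i, j)` of positive integers
with `iα + jβ ∈ Σ(α, β)`.  If `α` and `β` are linearly independent, then
`(i, j) ↦ iα + jβ` is a bijection from this set onto `Σ(α, β)`. -/
structure CommIndex (R : Realization A H) (α β : Dual ℂ H) where
  i : ℕ
  j : ℕ
  i_pos : 0 < i
  j_pos : 0 < j
  mem : i • α + j • β ∈ rootSpan R α β

/-- The root `iα + jβ`. -/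
def CommIndex.root {R : Realization A H} {α β : Dual ℂ H} (p : CommIndex R α β) : Dual ℂ H :=
  p.i • α + p.j • β

theorem rootSpan_subset_roots (R : Realization A H) (α β : Dual ℂ H) :
    rootSpan R α β ⊆ roots R := by
  intro γ hγ
  obtain ⟨n, hn⟩ := Set.mem_iUnion.1 hγ
  cases n with
  | zero => exact hn.2
  | succ n => exact hn.2

theorem CommIndex.root_mem {R : Realization A H} {α β : Dual ℂ H} (hα : α ∈ posRoots R)
    (hβ : β ∈ posRoots R) (p : CommIndex R α β) : p.root ∈ posRoots R := by
  refine ⟨rootSpan_subset_roots R α β p.mem, ?_⟩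
  obtain ⟨k, hk⟩ := hα.2
  obtain ⟨l, hl⟩ := hβ.2
  refine ⟨fun t => p.i * k t + p.j * l t, ?_⟩
  rw [CommIndex.root]
  conv_lhs => enter [1, 2]; rw [hk]
  conv_lhs => enter [2, 2]; rw [hl]
  simp only [Finset.smul_sum, add_smul, mul_smul, Finset.sum_add_distrib]

/-! ### Weight modules and weight lattices -/

/-- `V_μ = {v | h v = μ(h) v for all h ∈ 𝔥}`. -/
def weightSpace (R : Realization A H) (V : Type*) [AddCommGroup V] [Module ℂ V]
    [LieRingModule (Alg R) V] [LieModule ℂ (Alg R) V] (μ : Dual ℂ H) : Submodule ℂ V where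
  carrier := {v | ∀ h : H, ⁅ofH R h, v⁆ = μ h • v}
  add_mem' := by
    intro x y hx hy h
    rw [lie_add, hx h, hy h, smul_add]
  zero_mem' := by
    intro h
    simp
  smul_mem' := by
    intro c x hx h
    rw [lie_smul, hx h, smul_comm]

/-- The set of weights of `V`. -/
def wts (R : Realization A H) (V : Type*) [AddCommGroup V] [Module ℂ V]
    [LieRingModule (Alg R) V] [LieModule ℂ (Alg R) V] : Set (Dual ℂ H) :=
  {μ | weightSpace R V μ ≠ ⊥}

open Classical in
/-- `V` is a weight module: it is the direct sum of its weight spaces, which are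
finite dimensional. -/
structure IsWeightModule (R : Realization A H) (V : Type*) [AddCommGroup V] [Module ℂ V]
    [LieRingModule (Alg R) V] [LieModule ℂ (Alg R) V] : Prop where
  diagonalizable : DirectSum.IsInternal (weightSpace R V)
  finDim : ∀ μ, FiniteDimensional ℂ (weightSpace R V μ)

/-- A restricted weight lattice: an integral lattice containing the root lattice, with a
`ℤ`-basis that is also a `ℂ`-basis of `𝔥*` and extends a set of fundamental weights `ω_i`
(so it contains the weight `∑ ω_i`, the smallest regular dominant one). -/
structure WeightLattice [DecidableEq ι] (R : Realization A H) where
  P : AddSubgroup (Dual ℂ H)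
  root_mem : ∀ i, R.root i ∈ P
  integral : ∀ μ ∈ P, ∀ i, ∃ n : ℤ, μ (R.coroot i) = n
  restricted : ∃ (b : Basis (Fin (finrank ℂ H)) ℂ (Dual ℂ H)) (s : ι ↪ Fin (finrank ℂ H)),
    (∀ i j, b (s i) (R.coroot j) = if i = j then 1 else 0) ∧
      P = AddSubgroup.closure (Set.range b)

end algebra

/-! ### Standard graded modules -/

section graded

variable {ι : Type*} [Fintype ι] [DecidableEq ι] {A : Matrix ι ι ℤ}
  {H : Type*} [AddCommGroup H] [Module ℂ H] {R : Realization A H}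

/-- `Δ_m`, as a set of elements of `P`. -/
def rootsAt (L : WeightLattice R) (f : L.P →+ ℤ) (m : ℤ) : Set L.P :=
  {γ | ((γ : Dual ℂ H) ∈ roots R ∨ γ = 0) ∧ f γ = m}

/-- `wts_m(V)`, as a set of elements of `P`. -/
def wtsAt (L : WeightLattice R) (f : L.P →+ ℤ) (V : Type*) [AddCommGroup V] [Module ℂ V]
    [LieRingModule (Alg R) V] [LieModule ℂ (Alg R) V] (m : ℤ) : Set L.P :=
  {μ | (μ : Dual ℂ H) ∈ wts R V ∧ f μ = m}

/-- A `ℤ`-linear function `f : P → ℤ` that makes `V` a standard graded module. -/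
structure StandardGrading (L : WeightLattice R) (V : Type*) [AddCommGroup V] [Module ℂ V]
    [LieRingModule (Alg R) V] [LieModule ℂ (Alg R) V] where
  wts_subset : ∀ μ ∈ wts R V, μ ∈ L.P
  f : L.P →+ ℤ
  finite_roots : ∀ m, (rootsAt L f m).Finite
  finite_wts : ∀ m, (wtsAt L f V m).Finite
  roots_pos : ∀ m > 0, ∀ γ ∈ rootsAt L f m, (γ : Dual ℂ H) ∈ posRoots R
  roots_zero : rootsAt L f 0 = {0}
  roots_neg : ∀ m < 0, ∀ γ ∈ rootsAt L f m, (γ : Dual ℂ H) ∈ negRoots R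
  /-- Distinct weights in `wts_m(V)` are incomparable for the dominance order. -/
  incomparable : ∀ m, ∀ μ ∈ wtsAt L f V m, ∀ ν ∈ wtsAt L f V m,
    ((ν : Dual ℂ H) - (μ : Dual ℂ H)) ∈ posCone R → μ = ν

theorem posRoots_mem_lattice (L : WeightLattice R) {γ : Dual ℂ H} (hγ : γ ∈ posRoots R) :
    γ ∈ L.P := by
  obtain ⟨k, rfl⟩ := hγ.2
  exact sum_mem fun i _ => nsmul_mem (L.root_mem i) _

variable {L : WeightLattice R} {V : Type*} [AddCommGroup V] [Module ℂ V]
  [LieRingModule (Alg R) V] [LieModule ℂ (Alg R) V]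

namespace StandardGrading

/-- `𝔤_m`. -/
def gPart (F : StandardGrading L V) (m : ℤ) : Submodule ℂ (Alg R) :=
  ⨆ γ ∈ rootsAt L F.f m, rootSpace R (γ : Dual ℂ H)

/-- `V_m`. -/
def vPart (F : StandardGrading L V) (m : ℤ) : Submodule ℂ V :=
  ⨆ μ ∈ wtsAt L F.f V m, weightSpace R V (μ : Dual ℂ H)

/-- The degree of a positive root. -/
def deg (F : StandardGrading L V) {γ : Dual ℂ H} (hγ : γ ∈ posRoots R) : ℤ :=
  F.f ⟨γ, posRoots_mem_lattice L hγ⟩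

theorem deg_pos (F : StandardGrading L V) {γ : Dual ℂ H} (hγ : γ ∈ posRoots R) :
    0 < F.deg hγ := by
  have hmem : (⟨γ, posRoots_mem_lattice L hγ⟩ : L.P) ∈ rootsAt L F.f (F.deg hγ) :=
    ⟨Or.inl hγ.1, rfl⟩
  rcases lt_trichotomy (F.deg hγ) 0 with h | h | h
  · exfalso
    have hneg := (F.roots_neg _ h _ hmem).2
    obtain ⟨l, hl⟩ := hneg
    obtain ⟨k, hk⟩ := hγ.2
    simp only at hl
    have hsum : ∑ i, (((k i + l i : ℕ)) : ℂ) • R.root i = 0 := by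
      have : ∑ i, (k i + l i) • R.root i = 0 := by
        simp only [add_smul, Finset.sum_add_distrib]
        rw [← hk, ← hl, add_neg_cancel]
      simpa only [Nat.cast_smul_eq_nsmul] using this
    have h0 := Fintype.linearIndependent_iff.1 R.root_linearIndependent _ hsum
    apply hγ.1.1
    rw [hk]
    refine Finset.sum_eq_zero fun i _ => ?_
    have := h0 i
    have : k i + l i = 0 := by exact_mod_cast this
    have : k i = 0 := by omega
    simp [this]
  · exfalso
    rw [h, F.roots_zero] at hmem
    exact hγ.1.1 (congrArg Subtype.val hmem)
  · exact h

theorem rootSpace_le_gPart (F : StandardGrading L V) {γ : Dual ℂ H} (hγ : γ ∈ posRoots R) :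
    rootSpace R γ ≤ F.gPart (F.deg hγ) := by
  have hmem : (⟨γ, posRoots_mem_lattice L hγ⟩ : L.P) ∈ rootsAt L F.f (F.deg hγ) :=
    ⟨Or.inl hγ.1, rfl⟩
  exact le_iSup₂_of_le (f := fun (γ : L.P) (_ : γ ∈ rootsAt L F.f (F.deg hγ)) =>
    rootSpace R (γ : Dual ℂ H)) _ hmem le_rfl

set_option linter.unusedSectionVars false in
theorem lie_mem_weightSpace {γ μ : Dual ℂ H} {x : Alg R} {v : V}
    (hx : x ∈ rootSpace R γ) (hv : v ∈ weightSpace R V μ) :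
    ⁅x, v⁆ ∈ weightSpace R V (γ + μ) := by
  intro h
  rw [leibniz_lie, hx h, hv h, smul_lie, lie_smul, LinearMap.add_apply, add_smul]

theorem lie_mem_vPart (F : StandardGrading L V) {k m : ℤ} {x : Alg R} {v : V}
    (hx : x ∈ F.gPart k) (hv : v ∈ F.vPart m) : ⁅x, v⁆ ∈ F.vPart (k + m) := by
  have h1 : ∀ γ ∈ rootsAt L F.f k, ∀ μ ∈ wtsAt L F.f V m, ∀ x ∈ rootSpace R (γ : Dual ℂ H),
      ∀ v ∈ weightSpace R V (μ : Dual ℂ H), ⁅x, v⁆ ∈ F.vPart (k + m) := by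
    intro γ hγ μ hμ x hx v hv
    have h := lie_mem_weightSpace hx hv
    by_cases hb : weightSpace R V ((γ : Dual ℂ H) + (μ : Dual ℂ H)) = ⊥
    · rw [hb, Submodule.mem_bot] at h
      rw [h]
      exact zero_mem _
    · have hmem : γ + μ ∈ wtsAt L F.f V (k + m) :=
        ⟨hb, by rw [map_add, hγ.2, hμ.2]⟩
      exact Submodule.mem_iSup_of_mem (γ + μ) (Submodule.mem_iSup_of_mem hmem h)
  have h2 : ∀ γ ∈ rootsAt L F.f k, ∀ x ∈ rootSpace R (γ : Dual ℂ H),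
      F.vPart m ≤ (F.vPart (k + m)).comap (LieModule.toEnd ℂ (Alg R) V x) := by
    intro γ hγ x hx
    exact iSup₂_le fun μ hμ v hv => h1 γ hγ μ hμ x hx v hv
  have h3 : F.gPart k ≤ (F.vPart (k + m)).comap
      ((LieModule.toEnd ℂ (Alg R) V : Alg R →ₗ[ℂ] End ℂ V).flip v) :=
    iSup₂_le fun γ hγ x hx => h2 γ hγ x hx hv
  exact h3 hx

/-! ### The completion of `V` and the action of homogeneous elements -/

/-- `V̂ = ⨁_{m<0} V_m ⊕ ∏_{m≥0} V_m`: families `(v_m)`, `m ∈ ℤ`, with `v_m ∈ V_m` for all `m` and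
`v_m = 0` for all sufficiently small `m`. -/
def completion (F : StandardGrading L V) : Submodule ℂ (ℤ → V) where
  carrier := {v | (∀ m, v m ∈ F.vPart m) ∧ ∃ N : ℤ, ∀ m < N, v m = 0}
  add_mem' := by
    rintro v w ⟨hv, N, hN⟩ ⟨hw, N', hN'⟩
    refine ⟨fun m => add_mem (hv m) (hw m), min N N', fun m hm => ?_⟩
    rw [Pi.add_apply, hN m (lt_of_lt_of_le hm (min_le_left _ _)),
      hN' m (lt_of_lt_of_le hm (min_le_right _ _)), add_zero]
  zero_mem' := ⟨fun m => zero_mem _, 0, fun m _ => rfl⟩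
  smul_mem' := by
    rintro c v ⟨hv, N, hN⟩
    refine ⟨fun m => Submodule.smul_mem _ c (hv m), N, fun m hm => ?_⟩
    rw [Pi.smul_apply, hN m hm, smul_zero]

/-- `V̂`. -/
abbrev Hat (F : StandardGrading L V) : Type _ := F.completion

/-- `GL(V̂)`. -/
abbrev GLHat (F : StandardGrading L V) : Type _ := LinearMap.GeneralLinearGroup ℂ F.Hat

/-- `v ∈ N̂_N`. -/
def OrdGE (F : StandardGrading L V) (N : ℤ) (v : F.Hat) : Prop := ∀ m < N, v.1 m = 0

/-- The operator `ρ(x)` on `V̂` for `x ∈ 𝔤_k`: its `m`-th component at `v` is `x · v_{m-k}`. -/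
def rhoHat (F : StandardGrading L V) (k : ℤ) (x : F.gPart k) : End ℂ F.Hat where
  toFun v := ⟨fun m => ⁅(x : Alg R), v.1 (m - k)⁆, by
    refine ⟨fun m => ?_, ?_⟩
    · have := F.lie_mem_vPart x.2 (v.2.1 (m - k))
      rwa [add_sub_cancel] at this
    · obtain ⟨N, hN⟩ := v.2.2
      refine ⟨N + k, fun m hm => ?_⟩
      change ⁅(x : Alg R), v.1 (m - k)⁆ = 0
      rw [hN (m - k) (by omega), lie_zero]⟩
  map_add' v w := by
    apply Subtype.ext
    funext m
    exact lie_add _ _ _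
  map_smul' c v := by
    apply Subtype.ext
    funext m
    exact lie_smul _ _ _

/-! ### Pro-summable exponentials -/

/-- `T` maps `N̂_N` to `N̂_{N+1}` for all `N`. -/
def Raising (F : StandardGrading L V) (T : End ℂ F.Hat) : Prop :=
  ∀ N v, F.OrdGE N v → F.OrdGE (N + 1) (T v)

theorem rhoHat_raising (F : StandardGrading L V) {k : ℤ} (hk : 0 < k) (x : F.gPart k) :
    F.Raising (F.rhoHat k x) := by
  intro N v hv m hm
  change ⁅(x : Alg R), v.1 (m - k)⁆ = 0
  rw [hv (m - k) (by omega), lie_zero]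

variable {F : StandardGrading L V} {T : End ℂ F.Hat}

theorem Raising.neg (hT : F.Raising T) : F.Raising (-T) := by
  intro N v hv m hm
  change -((T v).1 m) = 0
  rw [hT N v hv m hm, neg_zero]

theorem Raising.pow (hT : F.Raising T) (n : ℕ) {N : ℤ} {v : F.Hat} (hv : F.OrdGE N v) :
    F.OrdGE (N + n) ((T ^ n) v) := by
  induction n with
  | zero => simpa using hv
  | succ n ih =>
    have := hT _ _ ih
    rw [pow_succ', Module.End.mul_apply]
    have e : N + ((n + 1 : ℕ) : ℤ) = N + (n : ℤ) + 1 := by push_cast; ring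
    rwa [e]

/-- The `m`-th component of `exp(T) v = ∑ Tⁿ v / n!` (a sum with finitely many nonzero terms if
`T` is raising). -/
def expFun (T : End ℂ F.Hat) (v : F.Hat) (m : ℤ) : V :=
  ∑ᶠ n : ℕ, ((n.factorial : ℂ)⁻¹) • (((T ^ n) v).1 m)

theorem expFun_eq (hT : F.Raising T) {N : ℤ} {v : F.Hat} (hv : F.OrdGE N v) {m : ℤ} {M : ℕ}
    (hM : m < N + M) :
    expFun T v m = ∑ n ∈ Finset.range M, ((n.factorial : ℂ)⁻¹) • (((T ^ n) v).1 m) := by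
  refine finsum_eq_sum_of_support_subset _ fun n hn => ?_
  by_contra hc
  apply hn
  have hMn : M ≤ n := by simpa using hc
  change ((n.factorial : ℂ)⁻¹) • (((T ^ n) v).1 m) = 0
  rw [hT.pow n hv m (by omega), smul_zero]

theorem expFun_zero (hT : F.Raising T) {N : ℤ} {v : F.Hat} (hv : F.OrdGE N v) {m : ℤ}
    (hm : m < N) : expFun T v m = 0 := by
  rw [expFun_eq hT hv (M := 0) (by simpa using hm)]
  simp

/-- `exp(T) = ∑ Tⁿ / n!` for a raising operator `T` on `V̂`. -/
def expEnd (T : End ℂ F.Hat) (hT : F.Raising T) : End ℂ F.Hat where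
  toFun v := ⟨expFun T v, by
    obtain ⟨N, hN⟩ := v.2.2
    refine ⟨fun m => ?_, N, fun m hm => expFun_zero hT hN hm⟩
    rw [expFun_eq hT hN (M := (m - N + 1).toNat) (by omega)]
    exact sum_mem fun n _ => Submodule.smul_mem _ _ (((T ^ n) v).2.1 m)⟩
  map_add' v w := by
    apply Subtype.ext
    funext m
    obtain ⟨N, hN⟩ := v.2.2
    obtain ⟨N', hN'⟩ := w.2.2
    have hv : F.OrdGE (min N N') v := fun m hm => hN m (by omega)
    have hw : F.OrdGE (min N N') w := fun m hm => hN' m (by omega)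
    have hvw : F.OrdGE (min N N') (v + w) := fun m hm => by
      change v.1 m + w.1 m = 0
      rw [hv m hm, hw m hm, add_zero]
    have hM : m < min N N' + ((m - min N N' + 1).toNat : ℤ) := by omega
    change expFun T (v + w) m = expFun T v m + expFun T w m
    rw [expFun_eq hT hv hM, expFun_eq hT hw hM, expFun_eq hT hvw hM, ← Finset.sum_add_distrib]
    refine Finset.sum_congr rfl fun n _ => ?_
    rw [map_add, ← smul_add]
    rfl
  map_smul' c v := by
    apply Subtype.ext
    funext m
    obtain ⟨N, hN⟩ := v.2.2
    have hcv : F.OrdGE N (c • v) := fun m hm => by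
      change c • v.1 m = 0
      rw [hN m hm, smul_zero]
    have hM : m < N + ((m - N + 1).toNat : ℤ) := by omega
    change expFun T (c • v) m = c • expFun T v m
    rw [expFun_eq hT hN hM, expFun_eq hT hcv hM, Finset.smul_sum]
    refine Finset.sum_congr rfl fun n _ => ?_
    rw [map_smul, smul_comm c]
    rfl

/-- The truncations of the power series of `exp(X)` and `exp(-X)` are inverse modulo `X ^ M`. -/
theorem trunc_exp_mul (M : ℕ) : ∃ q : Polynomial ℂ,
    (∑ n ∈ Finset.range M, Polynomial.C ((n.factorial : ℂ)⁻¹) * Polynomial.X ^ n) *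
      (∑ n ∈ Finset.range M, Polynomial.C ((n.factorial : ℂ)⁻¹) * (-Polynomial.X) ^ n)
      = 1 + Polynomial.X ^ M * q := by
  have key : ∀ n : ℕ, n ≠ 0 → ∑ p ∈ Finset.HasAntidiagonal.antidiagonal n,
      ((p.1.factorial : ℂ)⁻¹ * ((-1) ^ p.2 * (p.2.factorial : ℂ)⁻¹)) = 0 := by
    intro n hn
    have h := congrArg (PowerSeries.coeff n) (PowerSeries.exp_mul_exp_neg_eq_one (A := ℂ))
    rw [PowerSeries.coeff_mul, PowerSeries.coeff_one, if_neg hn] at h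
    rw [← h]
    refine Finset.sum_congr rfl fun p _ => ?_
    simp [PowerSeries.evalNegHom, PowerSeries.coeff_rescale, PowerSeries.coeff_exp]
  have hd : Polynomial.X ^ M ∣
      ((∑ n ∈ Finset.range M, Polynomial.C ((n.factorial : ℂ)⁻¹) * Polynomial.X ^ n) *
      (∑ n ∈ Finset.range M, Polynomial.C ((n.factorial : ℂ)⁻¹) * (-Polynomial.X) ^ n) - 1) := by
    rw [Polynomial.X_pow_dvd_iff]
    intro d hd
    have c1 : ∀ k < M, (∑ n ∈ Finset.range M,
        Polynomial.C ((n.factorial : ℂ)⁻¹) * Polynomial.X ^ n).coeff k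
          = (k.factorial : ℂ)⁻¹ := by
      intro k hk
      simp only [Polynomial.finsetSum_coeff, Polynomial.coeff_C_mul_X_pow]
      simp [hk]
    have c2 : ∀ k < M, (∑ n ∈ Finset.range M,
        Polynomial.C ((n.factorial : ℂ)⁻¹) * (-Polynomial.X) ^ n).coeff k
          = (-1) ^ k * (k.factorial : ℂ)⁻¹ := by
      intro k hk
      have e : ∀ n : ℕ, Polynomial.C ((n.factorial : ℂ)⁻¹) * (-Polynomial.X) ^ n
          = Polynomial.C ((-1) ^ n * (n.factorial : ℂ)⁻¹) * Polynomial.X ^ n := by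
        intro n
        rw [neg_pow, Polynomial.C_mul, Polynomial.C_pow, Polynomial.C_neg, Polynomial.C_1]
        ring
      simp only [Polynomial.finsetSum_coeff, e, Polynomial.coeff_C_mul_X_pow]
      simp [hk]
    rw [Polynomial.coeff_sub, Polynomial.coeff_mul, Polynomial.coeff_one]
    have h3 : ∑ p ∈ Finset.HasAntidiagonal.antidiagonal d, (∑ n ∈ Finset.range M,
        Polynomial.C ((n.factorial : ℂ)⁻¹) * Polynomial.X ^ n).coeff p.1 *
        (∑ n ∈ Finset.range M,
        Polynomial.C ((n.factorial : ℂ)⁻¹) * (-Polynomial.X) ^ n).coeff p.2 =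
        ∑ p ∈ Finset.HasAntidiagonal.antidiagonal d,
      ((p.1.factorial : ℂ)⁻¹ * ((-1) ^ p.2 * (p.2.factorial : ℂ)⁻¹)) := by
      refine Finset.sum_congr rfl fun p hp => ?_
      have := Finset.HasAntidiagonal.mem_antidiagonal.1 hp
      rw [c1 p.1 (by omega), c2 p.2 (by omega)]
    rw [h3]
    by_cases h0 : d = 0
    · subst h0
      simp
    · rw [key d h0]
      simp [h0]
  obtain ⟨q, hq⟩ := hd
  exact ⟨q, by rw [← hq]; ring⟩

theorem expEnd_mul_expEnd_neg (hT : F.Raising T) :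
    expEnd T hT * expEnd (-T) hT.neg = 1 := by
  refine LinearMap.ext fun v => Subtype.ext (funext fun m => ?_)
  obtain ⟨N, hN⟩ := v.2.2
  have hv : F.OrdGE N v := hN
  obtain ⟨M, hM⟩ : ∃ M : ℕ, m < N + M := ⟨(m - N + 1).toNat, by omega⟩
  set w : F.Hat := expEnd (-T) hT.neg v with hw
  set w' : F.Hat := ∑ n ∈ Finset.range M, ((n.factorial : ℂ)⁻¹) • (((-T) ^ n) v) with hw'
  have hval : ∀ (s : Finset ℕ) (g : ℕ → F.Hat) (k : ℤ),
      (∑ n ∈ s, g n).1 k = ∑ n ∈ s, (g n).1 k := by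
    intro s g k
    rw [AddSubmonoidClass.coe_finsetSum, Finset.sum_apply]
  have hwN : F.OrdGE N w := fun k hk => expFun_zero hT.neg hv hk
  have hdiff : F.OrdGE (N + M) (w - w') := by
    intro k hk
    change w.1 k - w'.1 k = 0
    rw [hw', hval, sub_eq_zero]
    exact expFun_eq hT.neg hv hk
  change expFun T w m = v.1 m
  rw [expFun_eq hT hwN hM]
  have hstep : ∀ n ∈ Finset.range M, ((n.factorial : ℂ)⁻¹) • ((T ^ n) w).1 m
      = (((n.factorial : ℂ)⁻¹) • (T ^ n) w').1 m := by
    intro n _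
    have h := hT.pow n hdiff m (by omega)
    rw [map_sub] at h
    have h' : ((T ^ n) w).1 m = ((T ^ n) w').1 m := sub_eq_zero.1 h
    rw [h']
    rfl
  rw [Finset.sum_congr rfl hstep, ← hval]
  obtain ⟨q, hq⟩ := trunc_exp_mul M
  have hop : ∑ n ∈ Finset.range M, ((n.factorial : ℂ)⁻¹) • (T ^ n) w'
      = v + (T ^ M) ((Polynomial.aeval T q) v) := by
    have hop := congrArg (fun p => (Polynomial.aeval T p) v) hq
    simp only [map_mul, map_add, map_one, map_pow, Polynomial.aeval_X, Module.End.mul_apply,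
      LinearMap.add_apply, Module.End.one_apply] at hop
    rw [← hop, hw']
    simp only [map_sum, map_mul, map_pow, map_neg, Polynomial.aeval_C, Polynomial.aeval_X,
      Module.End.mul_apply, LinearMap.sum_apply, Module.algebraMap_end_apply, Finset.smul_sum]
    rw [Finset.sum_comm]
  rw [hop]
  have hz : F.OrdGE N ((Polynomial.aeval T q) v) := by
    intro k hk
    rw [Polynomial.aeval_eq_sum_range, LinearMap.sum_apply, hval]
    refine Finset.sum_eq_zero fun n _ => ?_
    change q.coeff n • ((T ^ n) v).1 k = 0
    rw [hT.pow n hv k (by omega), smul_zero]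
  change v.1 m + ((T ^ M) ((Polynomial.aeval T q) v)).1 m = v.1 m
  rw [hT.pow M hz m hM, add_zero]

/-- `exp(T)` as an element of `GL(V̂)`. -/
def expGL (T : End ℂ F.Hat) (hT : F.Raising T) : F.GLHat where
  val := expEnd T hT
  inv := expEnd (-T) hT.neg
  val_inv := expEnd_mul_expEnd_neg hT
  inv_val := by
    have h : ∀ (S : End ℂ F.Hat) (hS : F.Raising S), S = T →
        expEnd (-T) hT.neg * expEnd S hS = 1 → expEnd (-T) hT.neg * expEnd T hT = 1 := by
      rintro S hS rfl h
      exact h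
    exact h _ hT.neg.neg (neg_neg T) (expEnd_mul_expEnd_neg hT.neg)

/-- `exp(ρ(x)) ∈ GL(V̂)` for `x ∈ 𝔤_k`, `k > 0`. -/
def expRho (F : StandardGrading L V) {k : ℤ} (hk : 0 < k) (x : F.gPart k) : F.GLHat :=
  expGL (F.rhoHat k x) (F.rhoHat_raising hk x)

/-- `exp(ρ(x)) ∈ GL(V̂)` for `x ∈ 𝔤_γ`, `γ` a positive root. -/
def expRoot (F : StandardGrading L V) {γ : Dual ℂ H} (hγ : γ ∈ posRoots R)
    (x : rootSpace R γ) : F.GLHat :=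
  F.expRho (F.deg_pos hγ) ⟨x, F.rootSpace_le_gPart hγ x.2⟩

/-! ### Ordered products -/

/-- The product of `a p` over a finite set `S` of indices, in the given total order of the indices,
read from the right to the left (the factor with the smallest index is the rightmost one). -/
def finProd {J : Type*} (F : StandardGrading L V) (ord : LinearOrder J) (a : J → F.GLHat)
    (S : Finset J) : F.GLHat :=
  (((S.sort (fun p q => ord.le p q)).reverse).map a).prod

/-- `g` is the product of all `a p`, `p ∈ J`, in the given total order of `J`: for each `v ∈ V̂` and
each `m`, the `m`-th component of `(∏_{p ∈ S} a p) v` equals that of `g v` for all sufficiently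
large finite subsets `S` of `J`. If `J` is finite, then `g` is the ordinary ordered product. -/
def IsOrderedProd {J : Type*} (F : StandardGrading L V) (ord : LinearOrder J) (a : J → F.GLHat)
    (g : F.GLHat) : Prop :=
  ∀ (v : F.Hat) (m : ℤ), ∀ᶠ S : Finset J in Filter.atTop,
    ((F.finProd ord a S).1 v).1 m = (g.1 v).1 m

/-- `Û^+_{V,1}`: the set of all products `⋯ exp(ρ(x_3)) exp(ρ(x_2)) exp(ρ(x_1))` with
`x_k ∈ 𝔤_k`. -/
def UHat (F : StandardGrading L V) : Set F.GLHat :=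
  {g | ∃ x : (k : ℕ+) → F.gPart ((k : ℕ) : ℤ),
    F.IsOrderedProd inferInstance
      (fun k : ℕ+ => F.expRho (by exact_mod_cast k.pos) (x k)) g}

/-- `V` is faithful on the positive part: no nonzero element of a positive root space acts as zero.
This holds in particular if `ρ` is injective. -/
def IsPosFaithful (R : Realization A H) (V : Type*) [AddCommGroup V] [Module ℂ V]
    [LieRingModule (Alg R) V] [LieModule ℂ (Alg R) V] : Prop :=
  ∀ γ ∈ posRoots R, ∀ z ∈ rootSpace R γ, (∀ v : V, ⁅z, v⁆ = 0) → z = 0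

/-- The group commutator `(a, b) = a b a⁻¹ b⁻¹`. -/
def comm {F : StandardGrading L V} (a b : F.GLHat) : F.GLHat := a * b * a⁻¹ * b⁻¹

/-- The commutator formula for `x ∈ 𝔤_α`, `y ∈ 𝔤_β` and elements `z_{ij} ∈ 𝔤_{iα+jβ}`: for all
`u, v ∈ ℂ`, the group commutator of `exp(uρ(x))` and `exp(vρ(y))` is the product of all
`exp(uⁱ vʲ ρ(z_{ij}))`, in the given total order of the pairs `(i, j)`. -/
def CommFormula (F : StandardGrading L V) {α β : Dual ℂ H} (hα : α ∈ posRoots R)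
    (hβ : β ∈ posRoots R) (ord : LinearOrder (CommIndex R α β))
    (x : rootSpace R α) (y : rootSpace R β)
    (z : (p : CommIndex R α β) → rootSpace R p.root) : Prop :=
  ∀ u v : ℂ, F.IsOrderedProd ord
    (fun p => F.expRoot (p.root_mem hα hβ) ((u ^ p.i * v ^ p.j) • z p))
    (comm (F.expRoot hα (u • x)) (F.expRoot hβ (v • y)))

end StandardGrading

end graded

end KM

end

/-! Replace `u` and `v` by formal variables. The commutator becomes a unit `C` in the ring of formal
power series in two variables over `End V`, where the exponent `(i, j)` carries the weight `i * deg
α + j * deg β`. Both degrees are positive, so only finitely many exponents lie below a given weight.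
All convergence questions thus become statements about the weight filtration `filt`.

That `C` is an ordered product of exponentials of Lie elements is proved without the
Baker–Campbell–Hausdorff formula. Let `E` be the Euler derivation, which multiplies each term by its
weight, and let `dlog C = E(C) * C⁻¹`. Then `dlog (C * C') = dlog C + C * dlog C' * C⁻¹`, and
conjugation by `exp X` is `exp (ad X)`. Hence, if `M` is a graded Lie algebra and `I ≤ M` contains
all brackets of `M`, then `dlog` is additive modulo `I` on the group generated by exponentials of
homogeneous elements of `M`. It follows that commutators have `dlog` in `I`
(`commutator_mem_lieGroup`). Here `M` consists of the brackets of `x` and `y`, and `I` of those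
involving both.

Two units with `dlog` in `I` that agree below weight `K > 0` differ in weight `K` by elements of
`I`, because `E` acts there as the nonzero scalar `K` (`coeff_sub_mem`). On the other hand, the
weight-`K` coefficient of an ordered product of exponentials of `z p * t ^ e p` is `z p` plus a term
depending only on the factors of smaller weight, whatever the order (`coeff_expProd`). This
triangular system is solved by recursion on the weight (`exists_expProd_eq`), and its solution is
unique (`expProd_injective`).

A nonzero right-normed bracket with `i` entries `x` and `j` entries `y` yields a chain of roots from
`α + β` to `iα + jβ`, so only exponents from the index set occur (`IsBracket.mem_rootSpan`). The
relation `Represents` links series to operators on the completion. Coefficients are recovered from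
values because a polynomial that vanishes on all complex points is zero.

The third claim follows from the same factorization in one variable, with `M = I` given by the
spaces `𝔤_k`. -/

noncomputable section

namespace KM

/-! ### Sums over antidiagonals -/

section antidiagonal

/-- The truncated Cauchy product: the pairs with `w (i + j) < K` form a part of the square `s × s`,
and `φ` vanishes on the rest of it. It serves both for summation indices in `ℕ` and for exponents.
-/
theorem sum_antidiagonal_eq_sum_sum {M N : Type*} [AddCommMonoid M] [DecidableEq M]
    [Finset.HasAntidiagonal M] [AddCommMonoid N] (w : M →+ ℕ) (K : ℕ) (s : Finset M)
    (hs : ∀ n, n ∈ s ↔ w n < K) (φ : M → M → N) (hφ : ∀ i j, K ≤ w (i + j) → φ i j = 0) :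
    ∑ k ∈ s, ∑ p ∈ Finset.HasAntidiagonal.antidiagonal k, φ p.1 p.2
      = ∑ i ∈ s, ∑ j ∈ s, φ i j := by
  rw [← Finset.sum_product', Finset.sum_sigma']
  refine Finset.sum_of_injOn (fun x => x.2) ?_ ?_ ?_ ?_
  · rintro ⟨k, p⟩ h ⟨k', p'⟩ h' (e : p = p')
    simp only [Finset.coe_sigma, Set.mem_sigma_iff, Finset.mem_coe,
      Finset.HasAntidiagonal.mem_antidiagonal] at h h'
    subst e
    obtain rfl : k = k' := h.2.symm.trans h'.2
    rfl
  · rintro ⟨k, p⟩ h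
    simp only [Finset.coe_sigma, Set.mem_sigma_iff, Finset.mem_coe,
      Finset.HasAntidiagonal.mem_antidiagonal, hs] at h
    obtain ⟨h1, rfl⟩ := h
    rw [map_add] at h1
    simp only [Finset.coe_product, Set.mem_prod, Finset.mem_coe, hs]
    omega
  · rintro ⟨i, j⟩ h h'
    refine hφ i j ?_
    by_contra hc
    exact h' ⟨⟨i + j, (i, j)⟩, by simpa [hs] using hc, rfl⟩
  · intros
    rfl

/-- The degree-`k` part of `exp a * exp b = exp (a + b)`, which is the binomial theorem. -/
theorem sum_antidiagonal_exp {A : Type*} [Ring A] [Algebra ℂ A] {a b : A} (h : Commute a b)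
    (k : ℕ) : ∑ p ∈ Finset.HasAntidiagonal.antidiagonal k,
      ((p.1.factorial : ℂ)⁻¹ • a ^ p.1) * ((p.2.factorial : ℂ)⁻¹ • b ^ p.2)
        = (k.factorial : ℂ)⁻¹ • (a + b) ^ k := by
  rw [h.add_pow', Finset.smul_sum]
  refine Finset.sum_congr rfl fun p hp => ?_
  obtain rfl := Finset.HasAntidiagonal.mem_antidiagonal.1 hp
  rw [smul_mul_smul_comm, ← Nat.cast_smul_eq_nsmul ℂ, smul_smul]
  congr 1
  have h3 : ((p.1 + p.2).choose p.1 : ℂ) * p.1.factorial * p.2.factorial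
      = (p.1 + p.2).factorial := by
    rw [Nat.choose_symm_add]
    exact_mod_cast Nat.add_choose_mul_factorial_mul_factorial p.1 p.2
  have h1 : (p.1.factorial : ℂ) ≠ 0 := by exact_mod_cast p.1.factorial_ne_zero
  have h2 : (p.2.factorial : ℂ) ≠ 0 := by exact_mod_cast p.2.factorial_ne_zero
  have h4 : ((p.1 + p.2).factorial : ℂ) ≠ 0 := by exact_mod_cast (p.1 + p.2).factorial_ne_zero
  field_simp
  rw [← h3]
  ring

end antidiagonal

/-! ### Power series over a noncommutative algebra, filtered by a weight of the exponents -/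

namespace Series

open MvPowerSeries

variable {σ : Type*} {B : Type*} [Ring B] [Algebra ℂ B]

/-- The series all of whose terms have weight at least `K`. -/
def filt (B : Type*) [Ring B] [Algebra ℂ B] (w : (σ →₀ ℕ) →+ ℕ) (K : ℕ) :
    Submodule ℂ (MvPowerSeries σ B) where
  carrier := {G | ∀ n, w n < K → coeff n G = 0}
  add_mem' := by
    intro a b ha hb n hn
    rw [map_add, ha n hn, hb n hn, add_zero]
  zero_mem' := fun _ _ => map_zero _
  smul_mem' := by
    intro c a ha n hn
    change c • coeff n a = 0
    rw [ha n hn, smul_zero]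

variable {w : (σ →₀ ℕ) →+ ℕ}

theorem filt_mono {K K' : ℕ} (h : K ≤ K') : filt B w K' ≤ filt B w K :=
  fun _ ha n hn => ha n (lt_of_lt_of_le hn h)

theorem mem_filt_zero (a : MvPowerSeries σ B) : a ∈ filt B w 0 :=
  fun _ hn => absurd hn (Nat.not_lt_zero _)

theorem mul_mem_filt {K K' : ℕ} {a b : MvPowerSeries σ B} (ha : a ∈ filt B w K)
    (hb : b ∈ filt B w K') : a * b ∈ filt B w (K + K') := by
  classical
  intro n hn
  rw [coeff_mul]
  refine Finset.sum_eq_zero fun p hp => ?_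
  obtain rfl := Finset.HasAntidiagonal.mem_antidiagonal.1 hp
  rw [map_add] at hn
  by_cases h : w p.1 < K
  · rw [ha _ h, zero_mul]
  · rw [hb p.2 (by omega), mul_zero]

theorem mul_left_mem_filt {K : ℕ} (a : MvPowerSeries σ B) {b : MvPowerSeries σ B}
    (hb : b ∈ filt B w K) : a * b ∈ filt B w K := by
  simpa using mul_mem_filt (mem_filt_zero a) hb

theorem mul_right_mem_filt {K : ℕ} {a : MvPowerSeries σ B} (ha : a ∈ filt B w K)
    (b : MvPowerSeries σ B) : a * b ∈ filt B w K := by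
  simpa using mul_mem_filt ha (mem_filt_zero b)

theorem pow_mem_filt {a : MvPowerSeries σ B} (ha : a ∈ filt B w 1) (k : ℕ) :
    a ^ k ∈ filt B w k := by
  induction k with
  | zero => exact mem_filt_zero _
  | succ k ih => rw [pow_succ]; exact mul_mem_filt ih ha

theorem eq_of_sub_mem_filt {a b : MvPowerSeries σ B} (h : ∀ K, a - b ∈ filt B w K) : a = b := by
  ext n
  have := h (w n + 1) n (Nat.lt_succ_self _)
  rwa [map_sub, sub_eq_zero] at this

/-- Right and left factors congruent to `1` do not change the leading terms. -/
theorem mul_sub_mem_filt {K : ℕ} {a c : MvPowerSeries σ B} (ha : a ∈ filt B w K)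
    (hc : c - 1 ∈ filt B w 1) : a * c - a ∈ filt B w (K + 1) := by
  have := mul_mem_filt ha hc
  rwa [mul_sub, mul_one] at this

theorem sub_mem_trans {K : ℕ} {a b c : MvPowerSeries σ B} (h : a - b ∈ filt B w K)
    (h' : b - c ∈ filt B w K) : a - c ∈ filt B w K := by
  simpa using add_mem h h'

theorem mul_sub_mul_mem_filt {K : ℕ} {a b a' b' : MvPowerSeries σ B}
    (h : a - a' ∈ filt B w K) (h' : b - b' ∈ filt B w K) : a * b - a' * b' ∈ filt B w K := by
  have := add_mem (mul_right_mem_filt h b) (mul_left_mem_filt a' h')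
  rwa [sub_mul, mul_sub, sub_add_sub_cancel] at this

theorem mul_sub_one_mem {a b : MvPowerSeries σ B} (h : a - 1 ∈ filt B w 1)
    (h' : b - 1 ∈ filt B w 1) : a * b - 1 ∈ filt B w 1 := by
  simpa using mul_sub_mul_mem_filt h h'

theorem inv_sub_one_mem {a : (MvPowerSeries σ B)ˣ} (h : (a : MvPowerSeries σ B) - 1 ∈ filt B w 1) :
    ((a⁻¹ : (MvPowerSeries σ B)ˣ) : MvPowerSeries σ B) - 1 ∈ filt B w 1 := by
  have := neg_mem (mul_left_mem_filt ((a⁻¹ : (MvPowerSeries σ B)ˣ) : MvPowerSeries σ B) h)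
  rwa [mul_sub, mul_one, Units.inv_mul, neg_sub] at this

theorem monomial_mem_filt (p : σ →₀ ℕ) (z : B) : monomial p z ∈ filt B w (w p) := by
  classical
  intro n hn
  rw [coeff_monomial, if_neg]
  rintro rfl
  exact lt_irrefl _ hn

/-! ### Infinite sums -/

/-- The sum of all `φ k`, provided that all terms of `φ k` have weight at least `k`. -/
def ssum (w : (σ →₀ ℕ) →+ ℕ) (φ : ℕ → MvPowerSeries σ B) : MvPowerSeries σ B :=
  fun n => ∑ k ∈ Finset.range (w n + 1), coeff n (φ k)

set_option linter.unusedSectionVars false in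
theorem coeff_ssum (φ : ℕ → MvPowerSeries σ B) (n : σ →₀ ℕ) :
    coeff n (ssum w φ) = ∑ k ∈ Finset.range (w n + 1), coeff n (φ k) := rfl

theorem ssum_sub_mem {φ : ℕ → MvPowerSeries σ B} (hφ : ∀ k, φ k ∈ filt B w k) (K : ℕ) :
    ssum w φ - ∑ k ∈ Finset.range K, φ k ∈ filt B w K := by
  intro n hn
  rw [map_sub, coeff_ssum, map_sum, sub_eq_zero]
  refine Finset.sum_subset (fun k hk => ?_) fun k _ hk => hφ k n ?_
  · simp only [Finset.mem_range] at hk ⊢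
    omega
  · simp only [Finset.mem_range] at hk
    omega

theorem eq_ssum {φ : ℕ → MvPowerSeries σ B} (hφ : ∀ k, φ k ∈ filt B w k) {a : MvPowerSeries σ B}
    (h : ∀ K, a - ∑ k ∈ Finset.range K, φ k ∈ filt B w K) : a = ssum w φ := by
  refine eq_of_sub_mem_filt (w := w) fun K => ?_
  have := sub_mem (h K) (ssum_sub_mem hφ K)
  rwa [sub_sub_sub_cancel_right] at this

/-- Modulo weight `K` both factors are finite partial sums, and the products `φ i * ψ j` with `K ≤ i
+ j` disappear. -/
theorem ssum_mul {φ ψ : ℕ → MvPowerSeries σ B} (hφ : ∀ k, φ k ∈ filt B w k)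
    (hψ : ∀ k, ψ k ∈ filt B w k) :
    ssum w φ * ssum w ψ = ssum w fun k =>
      ∑ p ∈ Finset.HasAntidiagonal.antidiagonal k, φ p.1 * ψ p.2 := by
  have hmem : ∀ p : ℕ × ℕ, φ p.1 * ψ p.2 ∈ filt B w (p.1 + p.2) := fun p =>
    mul_mem_filt (hφ _) (hψ _)
  refine eq_ssum (fun k => sum_mem fun p hp => ?_) fun K => ?_
  · have := hmem p
    rwa [Finset.HasAntidiagonal.mem_antidiagonal.1 hp] at this
  · refine sub_mem_trans (mul_sub_mul_mem_filt (ssum_sub_mem hφ K) (ssum_sub_mem hψ K)) ?_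
    intro n hn
    rw [map_sub, sub_eq_zero, Finset.sum_mul_sum]
    simp only [map_sum]
    refine (sum_antidiagonal_eq_sum_sum (AddMonoidHom.id ℕ) K (Finset.range K) (by simp)
      (fun i j => coeff n (φ i * ψ j)) fun i j hij => ?_).symm
    exact hmem (i, j) n (lt_of_lt_of_le hn hij)

/-! ### Exponentials -/

/-- The exponential series of `X`, where `X` has no constant term. -/
def fexp (w : (σ →₀ ℕ) →+ ℕ) (X : MvPowerSeries σ B) : MvPowerSeries σ B :=
  ssum w fun k => (k.factorial : ℂ)⁻¹ • X ^ k

theorem exp_term_mem {X : MvPowerSeries σ B} (hX : X ∈ filt B w 1) (k : ℕ) :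
    (k.factorial : ℂ)⁻¹ • X ^ k ∈ filt B w k :=
  Submodule.smul_mem _ _ (pow_mem_filt hX k)

theorem fexp_sub_mem {X : MvPowerSeries σ B} (hX : X ∈ filt B w 1) (K : ℕ) :
    fexp w X - ∑ k ∈ Finset.range K, (k.factorial : ℂ)⁻¹ • X ^ k ∈ filt B w K :=
  ssum_sub_mem (exp_term_mem hX) K

theorem fexp_sub_one_mem {X : MvPowerSeries σ B} {K : ℕ} (hK : 0 < K) (hX : X ∈ filt B w K) :
    fexp w X - 1 - X ∈ filt B w (K + 1) := by
  have hX1 : X ∈ filt B w 1 := filt_mono hK hX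
  intro n hn
  -- With `K + 2` terms, splitting off `1` and `X` leaves exactly `K` terms, each divisible by `X *
  -- X`. One factor has weight at least `K` and the other at least `1`.
  have h := fexp_sub_mem hX1 (K + 2) n (by omega)
  rw [Finset.sum_range_succ', Finset.sum_range_succ'] at h
  have h0 : coeff n (∑ k ∈ Finset.range K, ((k + 1 + 1).factorial : ℂ)⁻¹ • X ^ (k + 1 + 1)) = 0 := by
    have : ∑ k ∈ Finset.range K, ((k + 1 + 1).factorial : ℂ)⁻¹ • X ^ (k + 1 + 1)
        ∈ filt B w (K + 1) := by
      refine sum_mem fun k _ => Submodule.smul_mem _ _ ?_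
      rw [pow_succ', pow_succ']
      rw [← mul_assoc]
      exact mul_right_mem_filt (mul_mem_filt hX hX1) _
    exact this n hn
  simp only [map_sub, map_add] at h ⊢
  rw [h0] at h
  simp only [zero_add, Nat.factorial_zero, Nat.cast_one, inv_one, one_smul, pow_zero,
    Nat.factorial_one, pow_one] at h
  rw [← h]
  abel

theorem fexp_sub_one_mem' {X : MvPowerSeries σ B} {K : ℕ} (hK : 0 < K) (hX : X ∈ filt B w K) :
    fexp w X - 1 ∈ filt B w K := by
  have := add_mem (filt_mono (Nat.le_succ K) (fexp_sub_one_mem hK hX)) hX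
  rwa [sub_add_cancel] at this

/-- Since `X` and `-X` commute, the degree-`k` part of the product is `0 ^ k / k!`, which survives
only for `k = 0`. -/
theorem fexp_mul_fexp_neg {X : MvPowerSeries σ B} (hX : X ∈ filt B w 1) :
    fexp w X * fexp w (-X) = 1 := by
  rw [fexp, fexp, ssum_mul (exp_term_mem hX) (exp_term_mem (neg_mem hX))]
  simp only [sum_antidiagonal_exp ((Commute.refl X).neg_right)]
  rw [add_neg_cancel]
  refine (eq_ssum (fun k => Submodule.smul_mem _ _ (pow_mem_filt (zero_mem _) k)) fun K => ?_).symm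
  cases K with
  | zero => exact mem_filt_zero _
  | succ K =>
    rw [Finset.sum_range_succ']
    simp

theorem fexp_zero : fexp w (0 : MvPowerSeries σ B) = 1 := by
  refine eq_of_sub_mem_filt (w := w) fun K => ?_
  cases K with
  | zero => exact mem_filt_zero _
  | succ K => exact fexp_sub_one_mem' (Nat.succ_pos K) (zero_mem _)

/-- The exponential series of `X` as a unit. -/
def fexpU (X : MvPowerSeries σ B) (hX : X ∈ filt B w 1) : (MvPowerSeries σ B)ˣ where
  val := fexp w X
  inv := fexp w (-X)
  val_inv := fexp_mul_fexp_neg hX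
  inv_val := by simpa using fexp_mul_fexp_neg (neg_mem hX)

/-! ### The Euler derivation -/

/-- The derivation that multiplies the term with exponent `n` by `w n`. -/
def euler (w : (σ →₀ ℕ) →+ ℕ) : MvPowerSeries σ B →ₗ[ℂ] MvPowerSeries σ B where
  toFun a := fun n => (w n : ℂ) • coeff n a
  map_add' a b := by
    funext n
    change (w n : ℂ) • coeff n (a + b) = (w n : ℂ) • coeff n a + (w n : ℂ) • coeff n b
    rw [map_add, smul_add]
  map_smul' c a := by
    funext n
    exact smul_comm (w n : ℂ) c (coeff n a)

theorem coeff_euler (a : MvPowerSeries σ B) (n : σ →₀ ℕ) :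
    coeff n (euler w a) = (w n : ℂ) • coeff n a := rfl

theorem euler_mul (a b : MvPowerSeries σ B) :
    euler w (a * b) = euler w a * b + a * euler w b := by
  classical
  ext n
  rw [coeff_euler, map_add, coeff_mul, coeff_mul, coeff_mul, ← Finset.sum_add_distrib,
    Finset.smul_sum]
  refine Finset.sum_congr rfl fun p hp => ?_
  obtain rfl := Finset.HasAntidiagonal.mem_antidiagonal.1 hp
  rw [coeff_euler, coeff_euler, map_add, Nat.cast_add, add_smul, smul_mul_assoc, mul_smul_comm]

theorem euler_mem_filt {K : ℕ} {a : MvPowerSeries σ B} (ha : a ∈ filt B w K) :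
    euler w a ∈ filt B w K := fun n hn => by rw [coeff_euler, ha n hn, smul_zero]

theorem euler_one : euler w (1 : MvPowerSeries σ B) = 0 := by
  have := euler_mul (w := w) (1 : MvPowerSeries σ B) 1
  simpa using this

/-- For an eigenvector `X` of the derivation, `X` commutes with its derivative, so the usual power
rule holds in spite of noncommutativity. -/
theorem euler_pow {X : MvPowerSeries σ B} {c : ℂ} (hc : euler w X = c • X) (k : ℕ) :
    euler w (X ^ k) = (k * c) • X ^ k := by
  induction k with
  | zero => simp [euler_one]
  | succ k ih =>
    rw [pow_succ, euler_mul, ih, hc, smul_mul_assoc, mul_smul_comm, ← add_smul]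
    push_cast
    ring_nf

theorem euler_fexp {X : MvPowerSeries σ B} (hX : X ∈ filt B w 1) {c : ℂ}
    (hc : euler w X = c • X) : euler w (fexp w X) = (c • X) * fexp w X := by
  refine eq_of_sub_mem_filt (w := w) fun K => ?_
  have h1 := euler_mem_filt (fexp_sub_mem hX (K + 1))
  have h2 := mul_left_mem_filt (c • X) (fexp_sub_mem hX K)
  -- The derivation kills the term `k = 0` and turns the term `k + 1` into `c • X` times the term
  -- `k`. This is why the two truncations differ by one.
  have h3 : euler w (∑ k ∈ Finset.range (K + 1), (k.factorial : ℂ)⁻¹ • X ^ k)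
      = (c • X) * ∑ k ∈ Finset.range K, (k.factorial : ℂ)⁻¹ • X ^ k := by
    rw [map_sum, Finset.sum_range_succ', Finset.mul_sum]
    simp only [map_smul, euler_pow hc, Nat.cast_zero, zero_mul, zero_smul, smul_zero, add_zero]
    refine Finset.sum_congr rfl fun k _ => ?_
    rw [smul_mul_smul_comm, ← pow_succ', smul_smul]
    congr 1
    have : (k.factorial : ℂ) ≠ 0 := by exact_mod_cast k.factorial_ne_zero
    have : (k : ℂ) + 1 ≠ 0 := by exact_mod_cast k.succ_ne_zero
    rw [Nat.factorial_succ]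
    push_cast
    field_simp
  have := sub_mem (filt_mono (Nat.le_succ K) h1) h2
  rw [map_sub, mul_sub, h3, sub_sub_sub_cancel_right] at this
  exact this

theorem euler_monomial (p : σ →₀ ℕ) (z : B) :
    euler w (monomial p z) = (w p : ℂ) • monomial p z := by
  classical
  ext n
  change (w n : ℂ) • coeff n (monomial p z) = (w p : ℂ) • coeff n (monomial p z)
  rw [coeff_monomial]
  split_ifs with h
  · rw [h]
  · rw [smul_zero, smul_zero]

end Series

/-! ### Ordered products over finite sets -/

section ordProd

variable {J G : Type*} [Monoid G]

/-- The product of `a p` over a finite set of indices, read from the right to the left. -/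
def ordProd (ord : LinearOrder J) (a : J → G) (S : Finset J) : G :=
  ((S.sort (fun p q => ord.le p q)).reverse.map a).prod

theorem list_prod_map_filter_of_eq_one (l : List J) (P : J → Bool) (a : J → G)
    (h : ∀ p ∈ l, P p = false → a p = 1) : ((l.filter P).map a).prod = (l.map a).prod := by
  induction l with
  | nil => rfl
  | cons p l ih =>
    have ih := ih fun q hq => h q (List.mem_cons_of_mem _ hq)
    cases hp : P p with
    | true => rw [List.filter_cons_of_pos hp, List.map_cons, List.map_cons, List.prod_cons,
        List.prod_cons, ih]
    | false => rw [List.filter_cons_of_neg (by simp [hp]), List.map_cons, List.prod_cons, ih,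
        h p List.mem_cons_self hp, one_mul]

/-- The sorted list of `T` is the sorted list of `S` with the trivial factors deleted. -/
theorem ordProd_eq_of_subset (ord : LinearOrder J) {a : J → G} {S T : Finset J} (hTS : T ⊆ S)
    (h : ∀ p ∈ S, p ∉ T → a p = 1) : ordProd ord a S = ordProd ord a T := by
  classical
  have hsort : T.sort (fun p q => ord.le p q)
      = (S.sort (fun p q => ord.le p q)).filter (fun p => decide (p ∈ T)) := by
    refine List.Perm.eq_of_pairwise (le := fun p q => ord.le p q)
      (fun p q _ _ => ord.le_antisymm p q) (Finset.pairwise_sort _ _)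
      ((Finset.pairwise_sort _ _).filter _) ?_
    rw [List.perm_ext_iff_of_nodup (Finset.sort_nodup _ _) ((Finset.sort_nodup _ _).filter _)]
    intro p
    simp only [Finset.mem_sort, List.mem_filter, decide_eq_true_eq]
    exact ⟨fun hp => ⟨hTS hp, hp⟩, fun hp => hp.2⟩
  rw [ordProd, ordProd, hsort, ← List.filter_reverse]
  refine (list_prod_map_filter_of_eq_one _ _ _ fun p hp hpT => h p ?_ ?_).symm
  · simpa using hp
  · simpa using hpT

theorem map_ordProd {G' : Type*} [Monoid G'] (φ : G →* G') (ord : LinearOrder J) (a : J → G)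
    (S : Finset J) : φ (ordProd ord a S) = ordProd ord (fun p => φ (a p)) S := by
  rw [ordProd, map_list_prod, List.map_map]
  rfl

theorem ordProd_mem (ord : LinearOrder J) (P : G → Prop) (h1 : P 1)
    (hmul : ∀ a b, P a → P b → P (a * b)) {a : J → G} (ha : ∀ p, P (a p)) (S : Finset J) :
    P (ordProd ord a S) := by
  rw [ordProd]
  induction (S.sort (fun p q => ord.le p q)).reverse with
  | nil => exact h1
  | cons p l ih => rw [List.map_cons, List.prod_cons]; exact hmul _ _ (ha p) ih

end ordProd

namespace Series

open MvPowerSeries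

variable {σ : Type*} {B : Type*} [Ring B] [Algebra ℂ B] {w : (σ →₀ ℕ) →+ ℕ}

/-! ### Series with coefficients in a graded family of subspaces -/

/-- The series whose coefficient of exponent `n` lies in `M n` for all `n`. -/
def hat (M : (σ →₀ ℕ) → Submodule ℂ B) : Submodule ℂ (MvPowerSeries σ B) where
  carrier := {a | ∀ n, coeff n a ∈ M n}
  add_mem' := by
    intro a b ha hb n
    rw [map_add]
    exact add_mem (ha n) (hb n)
  zero_mem' := fun n => by
    rw [map_zero]
    exact zero_mem _
  smul_mem' := fun c a ha n => Submodule.smul_mem _ c (ha n)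

theorem hat_mono {M M' : (σ →₀ ℕ) → Submodule ℂ B} (h : ∀ n, M n ≤ M' n) : hat M ≤ hat M' :=
  fun _ ha n => h n (ha n)

theorem monomial_mem_hat {M : (σ →₀ ℕ) → Submodule ℂ B} {p : σ →₀ ℕ} {z : B} (hz : z ∈ M p) :
    monomial p z ∈ hat M := by
  classical
  intro n
  rw [coeff_monomial]
  split_ifs with h
  · rwa [h]
  · exact zero_mem _

/-- `I` is a graded subfamily of `M` that contains all commutators of homogeneous elements of `M`. -/
structure IsLiePair (M I : (σ →₀ ℕ) → Submodule ℂ B) : Prop where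
  le : ∀ n, I n ≤ M n
  lie_mem : ∀ p q, ∀ a ∈ M p, ∀ b ∈ M q, a * b - b * a ∈ I (p + q)

variable {M I D : (σ →₀ ℕ) → Submodule ℂ B}

theorem IsLiePair.lie_mem_hat (h : IsLiePair M I) {a b : MvPowerSeries σ B} (ha : a ∈ hat M)
    (hb : b ∈ hat M) : a * b - b * a ∈ hat I := by
  classical
  intro n
  -- Swapping the antidiagonal pairs each `a_p b_q` with `b_q a_p`, so every coefficient is a sum of
  -- commutators of homogeneous elements.
  have hswap : coeff n (b * a) = ∑ p ∈ Finset.HasAntidiagonal.antidiagonal n,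
      coeff p.2 b * coeff p.1 a := by
    rw [coeff_mul]
    refine Finset.sum_bij' (fun p _ => p.swap) (fun p _ => p.swap) ?_ ?_ ?_ ?_ ?_ <;>
      simp [add_comm]
  rw [map_sub, coeff_mul, hswap, ← Finset.sum_sub_distrib]
  refine sum_mem fun p hp => ?_
  obtain rfl := Finset.HasAntidiagonal.mem_antidiagonal.1 hp
  exact h.lie_mem _ _ _ (ha _) _ (hb _)

/-- The operator `ad X`. -/
def adOp (X : MvPowerSeries σ B) : End ℂ (MvPowerSeries σ B) :=
  LinearMap.mulLeft ℂ X - LinearMap.mulRight ℂ X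

theorem adOp_apply (X a : MvPowerSeries σ B) : adOp X a = X * a - a * X := rfl

theorem commute_adOp_mulRight (X : MvPowerSeries σ B) :
    Commute (adOp X) (LinearMap.mulRight ℂ X) :=
  Commute.sub_left (LinearMap.commute_mulLeft_right X X) (Commute.refl _)

theorem adOp_pow_mem_filt {X : MvPowerSeries σ B} (hX : X ∈ filt B w 1) (a : MvPowerSeries σ B)
    (k : ℕ) : (adOp X ^ k) a ∈ filt B w k := by
  induction k with
  | zero => exact mem_filt_zero _
  | succ k ih =>
    rw [pow_succ', Module.End.mul_apply, adOp_apply]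
    refine sub_mem ?_ (mul_mem_filt ih hX)
    rw [add_comm]
    exact mul_mem_filt hX ih

theorem IsLiePair.adOp_pow_mem (h : IsLiePair M I) {X a : MvPowerSeries σ B} (hX : X ∈ hat M)
    (ha : a ∈ hat M) (k : ℕ) : (adOp X ^ (k + 1)) a ∈ hat I := by
  induction k with
  | zero =>
    rw [zero_add, pow_one]
    exact h.lie_mem_hat hX ha
  | succ k ih =>
    rw [pow_succ', Module.End.mul_apply]
    exact h.lie_mem_hat hX (hat_mono h.le ih)

/-- `exp(X) a exp(-X) = exp(ad X) a`. -/
theorem fexp_mul {X : MvPowerSeries σ B} (hX : X ∈ filt B w 1) (a : MvPowerSeries σ B) :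
    fexp w X * a = ssum w (fun k => (k.factorial : ℂ)⁻¹ • (adOp X ^ k) a) * fexp w X := by
  rw [fexp, ssum_mul (fun k => Submodule.smul_mem _ _ (adOp_pow_mem_filt hX a k))
    (exp_term_mem hX)]
  have hterm : ∀ k : ℕ, ∑ p ∈ Finset.HasAntidiagonal.antidiagonal k,
      ((p.1.factorial : ℂ)⁻¹ • (adOp X ^ p.1) a) * ((p.2.factorial : ℂ)⁻¹ • X ^ p.2)
        = ((k.factorial : ℂ)⁻¹ • X ^ k) * a := by
    intro k
    have hk := congrArg (fun T : End ℂ (MvPowerSeries σ B) => T a)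
      (sum_antidiagonal_exp (commute_adOp_mulRight X) k)
    -- Left multiplication is the sum of the commuting operators `ad X` and right multiplication, so
    -- its exponential factors accordingly.
    have hL : adOp X + LinearMap.mulRight ℂ X = LinearMap.mulLeft ℂ X := by
      rw [adOp, sub_add_cancel]
    simp only [hL, LinearMap.pow_mulLeft, LinearMap.sum_apply, LinearMap.smul_apply,
      LinearMap.mulLeft_apply] at hk
    rw [smul_mul_assoc, ← hk]
    refine Finset.sum_congr rfl fun p _ => ?_
    rw [smul_mul_smul_comm, smul_mul_smul_comm, LinearMap.smul_apply,
      ((commute_adOp_mulRight X).pow_pow p.1 p.2).eq, Module.End.mul_apply, LinearMap.pow_mulRight,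
      LinearMap.mulRight_apply]
  simp only [hterm]
  refine eq_ssum (fun k => mul_right_mem_filt (exp_term_mem hX k) a) fun K => ?_
  rw [← Finset.sum_mul, ← sub_mul]
  exact mul_right_mem_filt (fexp_sub_mem hX K) a

/-- Conjugation is `exp (ad X)`. Its zeroth term is `a` itself, and every other term is a bracket of
elements of `M`. -/
theorem IsLiePair.fexp_conj_sub_mem (h : IsLiePair M I) {X a : MvPowerSeries σ B}
    (hX : X ∈ filt B w 1) (hXM : X ∈ hat M) (ha : a ∈ hat M) :
    fexp w X * a * fexp w (-X) - a ∈ hat I := by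
  rw [fexp_mul hX, mul_assoc, fexp_mul_fexp_neg hX, mul_one]
  intro n
  rw [map_sub, coeff_ssum, Finset.sum_range_succ']
  simp only [pow_zero, Nat.factorial_zero, Nat.cast_one, inv_one, one_smul, Module.End.one_apply,
    add_sub_cancel_right]
  exact sum_mem fun k _ => Submodule.smul_mem _ _ (h.adOp_pow_mem hXM ha k n)

/-! ### Logarithmic derivatives -/

/-- The logarithmic derivative for the Euler derivation. -/
def dlog (w : (σ →₀ ℕ) →+ ℕ) (C : (MvPowerSeries σ B)ˣ) : MvPowerSeries σ B :=
  euler w (C : MvPowerSeries σ B) * (C⁻¹ : (MvPowerSeries σ B)ˣ)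

theorem dlog_one : dlog w (1 : (MvPowerSeries σ B)ˣ) = 0 := by
  rw [dlog, Units.val_one, euler_one, zero_mul]

/-- `dlog` is a crossed homomorphism for the conjugation action. Where conjugation is trivial modulo
`I`, it is additive modulo `I`. -/
theorem dlog_mul (C C' : (MvPowerSeries σ B)ˣ) :
    dlog w (C * C') = dlog w C + C * dlog w C' * (C⁻¹ : (MvPowerSeries σ B)ˣ) := by
  simp only [dlog, Units.val_mul, mul_inv_rev, euler_mul, add_mul, mul_assoc]
  rw [Units.mul_inv_cancel_left]

theorem dlog_inv (C : (MvPowerSeries σ B)ˣ) :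
    dlog w C⁻¹ = -((C⁻¹ : (MvPowerSeries σ B)ˣ) * dlog w C * C) := by
  have h := dlog_mul (w := w) C⁻¹ C
  rw [inv_mul_cancel, dlog_one, inv_inv] at h
  exact eq_neg_of_add_eq_zero_left h.symm

/-- Conjugation by `C` preserves `M`, and is trivial modulo `I`. -/
def ConjTrivial (M I : (σ →₀ ℕ) → Submodule ℂ B) (C : (MvPowerSeries σ B)ˣ) : Prop :=
  ∀ a ∈ hat M, C * a * (C⁻¹ : (MvPowerSeries σ B)ˣ) - a ∈ hat I

theorem ConjTrivial.mem (hID : ∀ n, I n ≤ D n) (hDM : ∀ n, D n ≤ M n)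
    {C : (MvPowerSeries σ B)ˣ} (hC : ConjTrivial M I C) {a : MvPowerSeries σ B}
    (ha : a ∈ hat D) : C * a * (C⁻¹ : (MvPowerSeries σ B)ˣ) ∈ hat D := by
  have := add_mem (hat_mono hID (hC a (hat_mono hDM ha))) ha
  rwa [sub_add_cancel] at this

theorem ConjTrivial.mul (h : IsLiePair M I) {C C' : (MvPowerSeries σ B)ˣ}
    (hC : ConjTrivial M I C) (hC' : ConjTrivial M I C') : ConjTrivial M I (C * C') := by
  intro a ha
  have h1 := hC _ (hC'.mem h.le (fun _ => le_rfl) ha)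
  have := add_mem h1 (hC' a ha)
  rw [sub_add_sub_cancel] at this
  simpa only [Units.val_mul, mul_inv_rev, mul_assoc] using this

/-- The group of the series with constant term `1` that act on `M` by conjugation, trivially
modulo `I`, and have their logarithmic derivative in `D`, where `I ≤ D ≤ M`. -/
def lieGroup (w : (σ →₀ ℕ) →+ ℕ) (h : IsLiePair M I) (D : (σ →₀ ℕ) → Submodule ℂ B)
    (hID : ∀ n, I n ≤ D n) (hDM : ∀ n, D n ≤ M n) : Subgroup (MvPowerSeries σ B)ˣ where
  carrier := {C | (C : MvPowerSeries σ B) - 1 ∈ filt B w 1 ∧ ConjTrivial M I C ∧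
    ConjTrivial M I C⁻¹ ∧ dlog w C ∈ hat D}
  mul_mem' := by
    rintro a b ⟨h1, h2, h3, h4⟩ ⟨k1, k2, k3, k4⟩
    refine ⟨mul_sub_one_mem h1 k1, h2.mul h k2, ?_, ?_⟩
    · rw [mul_inv_rev]
      exact k3.mul h h3
    · rw [dlog_mul]
      exact add_mem h4 (h2.mem hID hDM k4)
  one_mem' := by
    refine ⟨by simp, fun a _ => by simp, fun a _ => by simp, ?_⟩
    rw [dlog_one]
    exact zero_mem _
  inv_mem' := by
    rintro a ⟨h1, h2, h3, h4⟩
    refine ⟨inv_sub_one_mem h1, h3, by rwa [inv_inv], ?_⟩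
    rw [dlog_inv]
    have := h3.mem hID hDM h4
    rw [inv_inv] at this
    exact neg_mem this

variable {h : IsLiePair M I} {hID : ∀ n, I n ≤ D n} {hDM : ∀ n, D n ≤ M n}

/-- A monomial is an eigenvector of the Euler derivation, so the logarithmic derivative of its
exponential is a multiple of the monomial itself. -/
theorem fexpU_mem_lieGroup {p : σ →₀ ℕ} {z : B} (hz : z ∈ D p)
    (hp : monomial p z ∈ filt B w 1) :
    fexpU (monomial p z) hp ∈ lieGroup w h D hID hDM := by
  have hM : monomial p z ∈ hat M := hat_mono hDM (monomial_mem_hat hz)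
  refine ⟨fexp_sub_one_mem' one_pos hp, fun a ha => h.fexp_conj_sub_mem hp hM ha, fun a ha => ?_, ?_⟩
  · have := h.fexp_conj_sub_mem (neg_mem hp) (neg_mem hM) ha
    rwa [neg_neg] at this
  · have he : dlog w (fexpU (monomial p z) hp) = (w p : ℂ) • monomial p z := by
      change euler w (fexp w (monomial p z)) * fexp w (-monomial p z) = _
      rw [euler_fexp hp (euler_monomial p z), mul_assoc, fexp_mul_fexp_neg hp, mul_one]
    rw [he]
    exact Submodule.smul_mem _ _ (monomial_mem_hat hz)

/-- Commutators have their logarithmic derivative in `I`. -/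
theorem commutator_mem_lieGroup {a b : (MvPowerSeries σ B)ˣ}
    (ha : a ∈ lieGroup w h M h.le fun _ => le_rfl) (hb : b ∈ lieGroup w h M h.le fun _ => le_rfl) :
    a * b * a⁻¹ * b⁻¹ ∈ lieGroup w h I (fun _ => le_rfl) h.le := by
  have hadd : ∀ a ∈ lieGroup w h M h.le fun _ => le_rfl,
      ∀ b ∈ lieGroup w h M h.le fun _ => le_rfl,
      dlog w (a * b) - (dlog w a + dlog w b) ∈ hat I := by
    intro a ha b hb
    rw [dlog_mul, add_sub_add_left_eq_sub]
    exact ha.2.1 _ hb.2.2.2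
  have hg : a * b * a⁻¹ * b⁻¹ ∈ lieGroup w h M h.le fun _ => le_rfl :=
    mul_mem (mul_mem (mul_mem ha hb) (inv_mem ha)) (inv_mem hb)
  refine ⟨hg.1, hg.2.1, hg.2.2.1, ?_⟩
  -- Additivity modulo `I` is applied to `g * (b * a) = a * b`. The contributions of `a` and `b`
  -- cancel and leave `dlog g`.
  have h1 := hadd _ hg _ (mul_mem hb ha)
  have h2 := hadd _ hb _ ha
  have h3 := hadd _ ha _ hb
  have e : a * b * a⁻¹ * b⁻¹ * (b * a) = a * b := by group
  rw [e] at h1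
  have := sub_mem (sub_mem h3 h1) h2
  convert this using 1
  abel

/-- Two elements with logarithmic derivatives in `I` first differ by an element of `I`. -/
theorem coeff_sub_mem {G P : (MvPowerSeries σ B)ˣ}
    (hG : G ∈ lieGroup w h I (fun _ => le_rfl) h.le)
    (hP : P ∈ lieGroup w h I (fun _ => le_rfl) h.le) {K : ℕ} (hK : 0 < K)
    (hGP : (G : MvPowerSeries σ B) - P ∈ filt B w K) {n : σ →₀ ℕ} (hn : w n = K) :
    coeff n (G : MvPowerSeries σ B) - coeff n (P : MvPowerSeries σ B) ∈ I n := by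
  have hQ : G * P⁻¹ ∈ lieGroup w h I (fun _ => le_rfl) h.le := mul_mem hG (inv_mem hP)
  set Q := G * P⁻¹ with hQdef
  -- The quotient `Q = G * P⁻¹` turns the difference `G - P` into `Q - 1` without changing the terms
  -- of weight `K`.
  have h1 : (Q : MvPowerSeries σ B) - 1 - (G - P) ∈ filt B w (K + 1) := by
    have := mul_sub_mem_filt hGP (inv_mem hP).1
    rwa [sub_mul, Units.mul_inv, ← Units.val_mul] at this
  have h2 : (Q : MvPowerSeries σ B) - 1 ∈ filt B w K := by
    have := add_mem (filt_mono (Nat.le_succ K) h1) hGP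
    rwa [sub_add_cancel] at this
  have h3 : euler w ((Q : MvPowerSeries σ B) - 1) = euler w (Q : MvPowerSeries σ B) := by
    rw [map_sub, euler_one, sub_zero]
  have h4 : dlog w Q - euler w ((Q : MvPowerSeries σ B) - 1) ∈ filt B w (K + 1) := by
    rw [dlog, ← h3]
    exact mul_sub_mem_filt (euler_mem_filt h2) (inv_mem hQ).1
  -- In weight `K`, `dlog Q` equals the Euler derivative of `G - P`, that is, `K` times its
  -- coefficient. Membership in `I` survives division by `K`.
  have h5 := add_mem h4 (euler_mem_filt h1) n (by omega)
  rw [(euler w).map_sub (Q - 1 : MvPowerSeries σ B), sub_add_sub_cancel, map_sub, coeff_euler, sub_eq_zero, hn] at h5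
  have h6 := hQ.2.2.2 n
  rw [h5] at h6
  have hK0 : (K : ℂ) ≠ 0 := by exact_mod_cast hK.ne'
  have := Submodule.smul_mem _ (K : ℂ)⁻¹ h6
  rwa [inv_smul_smul₀ hK0, map_sub] at this

/-! ### Factorization into exponentials of homogeneous elements -/

/-- Modulo weight `K + 1`, a perturbation `c p` of weight `K` does not feel its neighbouring
factors, all congruent to `1`. The perturbations therefore simply add up, independently of the order
of the product. -/
theorem list_prod_sub_mem {J : Type*} {K : ℕ} (hK : 0 < K) {a b c : J → MvPowerSeries σ B}
    (hb : ∀ p, b p - 1 ∈ filt B w 1) (hc : ∀ p, c p ∈ filt B w K)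
    (habc : ∀ p, a p - b p - c p ∈ filt B w (K + 1)) (l : List J) :
    (l.map a).prod - (l.map b).prod - (l.map c).sum ∈ filt B w (K + 1) ∧
      (l.map b).prod - 1 ∈ filt B w 1 ∧ (l.map c).sum ∈ filt B w K := by
  induction l with
  | nil => simp
  | cons p l ih =>
    obtain ⟨h1, h2, h3⟩ := ih
    simp only [List.map_cons, List.prod_cons, List.sum_cons]
    refine ⟨?_, mul_sub_one_mem (hb p) h2, add_mem (hc p) h3⟩
    set X := (l.map a).prod
    set Y := (l.map b).prod
    set Z := (l.map c).sum
    have e : a p * X - b p * Y - (c p + Z) = (a p - b p - c p) * X + (b p + c p) * (X - Y - Z)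
        + ((b p - 1) * Z + c p * (Y - 1) + c p * Z) := by noncomm_ring
    rw [e]
    refine add_mem (add_mem (mul_right_mem_filt (habc p) _) (mul_left_mem_filt _ h1))
      (add_mem (add_mem ?_ (mul_mem_filt (hc p) h2)) ?_)
    · rw [add_comm K]
      exact mul_mem_filt (hb p) h3
    · exact filt_mono (by omega) (mul_mem_filt (hc p) h3)

section factorization

variable {J : Type*} (ord : LinearOrder J) {e : J → (σ →₀ ℕ)} (he : ∀ p, 0 < w (e p))

theorem monomial_mem_filt_one {p : σ →₀ ℕ} (hp : 0 < w p) (z : B) :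
    monomial p z ∈ filt B w 1 := filt_mono hp (monomial_mem_filt p z)

/-- The finite product of the exponentials of `z p t ^ (e p)`. -/
def expProd (z : J → B) (S : Finset J) : (MvPowerSeries σ B)ˣ :=
  ordProd ord (fun p => fexpU (monomial (e p) (z p)) (monomial_mem_filt_one (he p) (z p))) S

/-- The truncation of `z`. -/
def trunc (w : (σ →₀ ℕ) →+ ℕ) (e : J → (σ →₀ ℕ)) (z : J → B) (K : ℕ) : J → B :=
  fun p => if w (e p) < K then z p else 0

theorem expProd_sub_one_mem (z : J → B) (S : Finset J) :
    (expProd ord he z S : MvPowerSeries σ B) - 1 ∈ filt B w 1 :=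
  ordProd_mem ord (fun C : (MvPowerSeries σ B)ˣ => (C : MvPowerSeries σ B) - 1 ∈ filt B w 1)
    (by simp) (fun _ _ ha hb => mul_sub_one_mem ha hb)
    (fun p => fexp_sub_one_mem' one_pos (monomial_mem_filt_one (he p) (z p))) S

theorem expProd_mem_lieGroup {z : J → B} (hz : ∀ p, z p ∈ I (e p)) (S : Finset J) :
    expProd ord he z S ∈ lieGroup w h I (fun _ => le_rfl) h.le :=
  ordProd_mem ord (· ∈ lieGroup w h I (fun _ => le_rfl) h.le) (one_mem _)
    (fun _ _ ha hb => mul_mem ha hb) (fun p => fexpU_mem_lieGroup (hz p) _) S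

/-- Modulo weight `K + 1`, factors of weight above `K` are trivial, those of weight `K` are `1` plus
their linear term, and those of smaller weight are unchanged by the truncation. -/
theorem expProd_sub_expProd_trunc (z : J → B) (S : Finset J) {K : ℕ} (hK : 0 < K) :
    (expProd ord he z S : MvPowerSeries σ B) - expProd ord he (trunc w e z K) S
      - ∑ p ∈ S, (if w (e p) = K then monomial (e p) (z p) else 0) ∈ filt B w (K + 1) := by
  have hval : ∀ z : J → B, (expProd ord he z S : MvPowerSeries σ B)
      = ordProd ord (fun p => fexp w (monomial (e p) (z p))) S :=
    fun z => map_ordProd (Units.coeHom _) ord _ S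
  have hsum : ∀ c : J → MvPowerSeries σ B,
      ∑ p ∈ S, c p = ((S.sort (fun p q => ord.le p q)).reverse.map c).sum := by
    intro c
    rw [List.map_reverse, List.sum_reverse, ← Multiset.sum_coe, ← Multiset.map_coe,
      Finset.sort_eq]
    rfl
  rw [hval, hval, hsum]
  refine (list_prod_sub_mem hK (fun p => ?_) (fun p => ?_) (fun p => ?_) _).1
  · exact fexp_sub_one_mem' one_pos (monomial_mem_filt_one (he p) _)
  · split_ifs with hp
    · rw [← hp]
      exact monomial_mem_filt _ _
    · exact zero_mem _
  · rw [trunc]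
    rcases lt_trichotomy (w (e p)) K with hp | hp | hp
    · rw [if_pos hp, if_neg hp.ne, sub_self, sub_zero]
      exact zero_mem _
    · rw [if_neg hp.not_lt, if_pos hp, map_zero, fexp_zero]
      refine fexp_sub_one_mem hK ?_
      rw [← hp]
      exact monomial_mem_filt _ _
    · rw [if_neg hp.not_gt, if_neg hp.ne', map_zero, fexp_zero, sub_zero]
      exact fexp_sub_one_mem' (Nat.succ_pos K) (filt_mono hp (monomial_mem_filt _ _))

theorem coeff_expProd_of_lt (z : J → B) (S : Finset J) {K : ℕ} {n : σ →₀ ℕ} (hn : w n < K) :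
    coeff n (expProd ord he z S : MvPowerSeries σ B)
      = coeff n (expProd ord he (trunc w e z K) S : MvPowerSeries σ B) := by
  classical
  have := expProd_sub_expProd_trunc ord he z S (K := K) (by omega) n (by omega)
  rw [map_sub, map_sub, map_sum, Finset.sum_eq_zero, sub_zero, sub_eq_zero] at this
  · exact this
  · intro p _
    split_ifs with hp
    · exact monomial_mem_filt (w := w) (e p) (z p) n (by omega)
    · exact map_zero _

theorem coeff_expProd_of_notMem (z : J → B) (S : Finset J) {n : σ →₀ ℕ} (hn : 0 < w n)
    (hne : n ∉ Set.range e) : coeff n (expProd ord he z S : MvPowerSeries σ B)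
      = coeff n (expProd ord he (trunc w e z (w n)) S : MvPowerSeries σ B) := by
  classical
  have := expProd_sub_expProd_trunc ord he z S (K := w n) hn n (by omega)
  rw [map_sub, map_sub, map_sum, Finset.sum_eq_zero, sub_zero, sub_eq_zero] at this
  · exact this
  · intro p _
    split_ifs with hp
    · rw [coeff_monomial, if_neg]
      rintro rfl
      exact hne ⟨p, rfl⟩
    · exact map_zero _

/-- This is the triangularity: `z p` enters linearly, and the remaining summand depends only on
entries of strictly smaller weight. Injectivity of `e` ensures that no other factor contributes
linearly to the same exponent. -/
theorem coeff_expProd (hinj : Function.Injective e) (z : J → B) {S : Finset J} {p : J}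
    (hp : p ∈ S) : coeff (e p) (expProd ord he z S : MvPowerSeries σ B)
      = coeff (e p) (expProd ord he (trunc w e z (w (e p))) S : MvPowerSeries σ B) + z p := by
  classical
  have := expProd_sub_expProd_trunc ord he z S (K := w (e p)) (he p) (e p) (by omega)
  rw [map_sub, map_sub, map_sum, Finset.sum_eq_single p, if_pos rfl, coeff_monomial,
    if_pos rfl, sub_sub, sub_eq_zero] at this
  · exact this
  · intro q _ hq
    split_ifs
    · rw [coeff_monomial, if_neg fun h => hq (hinj h.symm)]
    · exact map_zero _
  · exact fun h => absurd hp h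

variable (hfin : ∀ K, {p | w (e p) < K}.Finite)

theorem expProd_trunc (z : J → B) {K : ℕ} {S : Finset J} (hS : (hfin K).toFinset ⊆ S) :
    expProd ord he (trunc w e z K) S = expProd ord he (trunc w e z K) (hfin K).toFinset := by
  refine ordProd_eq_of_subset ord hS fun p _ hp => Units.ext ?_
  have hp' : ¬ w (e p) < K := by simpa using hp
  change fexp w (monomial (e p) (trunc w e z K p)) = 1
  rw [trunc, if_neg hp', map_zero, fexp_zero]

theorem coeff_expProd_stable (z : J → B) {K : ℕ} {S : Finset J} (hS : (hfin K).toFinset ⊆ S)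
    {n : σ →₀ ℕ} (hn : w n < K) : coeff n (expProd ord he z S : MvPowerSeries σ B)
      = coeff n (expProd ord he z (hfin K).toFinset : MvPowerSeries σ B) := by
  rw [coeff_expProd_of_lt ord he z S hn, expProd_trunc ord he hfin z hS,
    coeff_expProd_of_lt ord he z (hfin K).toFinset hn]

/-- Induction on the weight: once the entries below `w (e p)` agree, the lower-order summands in
`coeff_expProd` agree and cancel. -/
theorem expProd_injective (hinj : Function.Injective e) {z z' : J → B}
    (hz : ∀ K n, w n < K → coeff n (expProd ord he z (hfin K).toFinset : MvPowerSeries σ B)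
      = coeff n (expProd ord he z' (hfin K).toFinset : MvPowerSeries σ B)) : z = z' := by
  have key : ∀ K p, w (e p) < K → z p = z' p := by
    intro K
    induction K with
    | zero => intro p hp; omega
    | succ K ih =>
      intro p hp
      by_cases hp' : w (e p) < K
      · exact ih p hp'
      · obtain rfl : w (e p) = K := by omega
        have htr : trunc w e z (w (e p)) = trunc w e z' (w (e p)) := by
          funext q
          rw [trunc, trunc]
          split_ifs with hq
          · exact ih q hq
          · rfl
        have h1 := hz (w (e p) + 1) (e p) (by omega)
        have hmem : p ∈ (hfin (w (e p) + 1)).toFinset := by simp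
        rw [coeff_expProd ord he hinj z hmem, coeff_expProd ord he hinj z' hmem, htr] at h1
        exact add_left_cancel h1
  exact funext fun p => key _ p (Nat.lt_succ_self _)

/-- The recursive construction of the factors of `G`. -/
def factorAux (G : MvPowerSeries σ B) : ℕ → J → B
  | 0 => 0
  | K + 1 => fun p => if w (e p) = K then
      coeff (e p) G - coeff (e p) (expProd ord he (factorAux G K) (hfin K).toFinset :
        MvPowerSeries σ B)
      else factorAux G K p

theorem factorAux_succ (G : MvPowerSeries σ B) (K : ℕ) (p : J) :
    factorAux ord he hfin G (K + 1) p = if w (e p) = K then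
      coeff (e p) G - coeff (e p) (expProd ord he (factorAux ord he hfin G K) (hfin K).toFinset :
        MvPowerSeries σ B)
      else factorAux ord he hfin G K p := rfl

/-- Stage `K + 1` changes only the entries of weight exactly `K`, and the recursion starts from
zero. The entry at `p` is therefore final from stage `w (e p) + 1` on, and zero before. -/
theorem factorAux_eq (G : MvPowerSeries σ B) (K : ℕ) : factorAux ord he hfin G K
    = trunc w e (fun p => factorAux ord he hfin G (w (e p) + 1) p) K := by
  induction K with
  | zero => funext p; simp [factorAux, trunc]
  | succ K ih =>
    funext p
    rw [factorAux_succ, trunc]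
    by_cases hp : w (e p) = K
    · rw [if_pos hp, if_pos (by omega), hp, factorAux_succ, if_pos hp]
    · rw [if_neg hp, ih, trunc]
      by_cases hp' : w (e p) < K
      · rw [if_pos hp', if_pos (by omega)]
      · rw [if_neg hp', if_neg (by omega)]

/-- A series with logarithmic derivative in `I` is an ordered product of exponentials of
homogeneous elements of `I`. -/
theorem exists_expProd_eq (hinj : Function.Injective e) {G : (MvPowerSeries σ B)ˣ}
    (hG : G ∈ lieGroup w h I (fun _ => le_rfl) h.le)
    (hI : ∀ n, 0 < w n → n ∉ Set.range e → I n = ⊥) :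
    ∃ z : J → B, (∀ p, z p ∈ I (e p)) ∧ ∀ K n, w n < K → ∀ S, (hfin K).toFinset ⊆ S →
      coeff n (expProd ord he z S : MvPowerSeries σ B) = coeff n (G : MvPowerSeries σ B) := by
  set z : J → B := fun p => factorAux ord he hfin (G : MvPowerSeries σ B) (w (e p) + 1) p with hz
  have hzp : ∀ p, z p = coeff (e p) (G : MvPowerSeries σ B) - coeff (e p)
      (expProd ord he (trunc w e z (w (e p))) (hfin (w (e p))).toFinset : MvPowerSeries σ B) := by
    intro p
    change factorAux ord he hfin (G : MvPowerSeries σ B) (w (e p) + 1) p = _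
    rw [factorAux_succ, if_pos rfl, factorAux_eq]
  have key : ∀ K, (∀ p, w (e p) < K → z p ∈ I (e p)) ∧ ∀ n, w n < K → ∀ S,
      (hfin K).toFinset ⊆ S →
      coeff n (expProd ord he z S : MvPowerSeries σ B) = coeff n (G : MvPowerSeries σ B) := by
    intro K
    induction K with
    | zero => exact ⟨fun p hp => absurd hp (Nat.not_lt_zero _), fun n hn => absurd hn (Nat.not_lt_zero _)⟩
    | succ K ih =>
      obtain ⟨ih1, ih2⟩ := ih
      have hmono : (hfin K).toFinset ⊆ (hfin (K + 1)).toFinset := by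
        intro p hp
        simp only [Set.Finite.mem_toFinset, Set.mem_ofPred_eq] at hp ⊢
        omega
      have hP : expProd ord he (trunc w e z K) (hfin K).toFinset
          ∈ lieGroup w h I (fun _ => le_rfl) h.le := by
        refine expProd_mem_lieGroup ord he (fun p => ?_) _
        rw [trunc]
        split_ifs with hp
        · exact ih1 p hp
        · exact zero_mem _
      have hGP : (G : MvPowerSeries σ B) - expProd ord he (trunc w e z K) (hfin K).toFinset
          ∈ filt B w K := by
        intro n hn
        rw [map_sub, ← ih2 n hn _ subset_rfl, ← coeff_expProd_of_lt ord he z _ hn, sub_self]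
      -- The truncated product already has its factors in `I` by induction and agrees with `G` below
      -- weight `K`, so the leading difference lies in `I`.
      have hlead : ∀ n, w n = K → 0 < K → coeff n (G : MvPowerSeries σ B) - coeff n
          (expProd ord he (trunc w e z K) (hfin K).toFinset : MvPowerSeries σ B) ∈ I n :=
        fun n hn hK => coeff_sub_mem hG hP hK hGP hn
      refine ⟨fun p hp => ?_, fun n hn S hS => ?_⟩
      · by_cases hp' : w (e p) < K
        · exact ih1 p hp'
        · obtain rfl : w (e p) = K := by omega
          rw [hzp]
          exact hlead _ rfl (he p)
      · by_cases hn' : w n < K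
        · exact ih2 n hn' S (hmono.trans hS)
        · obtain rfl : w n = K := by omega
          -- In weight zero both series agree with `1`. In positive weight, an exponent `e p` is
          -- matched by the choice of `z p`; at any other exponent the difference lies in `I n = ⊥`.
          rcases Nat.eq_zero_or_pos (w n) with h0 | h0
          · have := sub_mem (expProd_sub_one_mem ord he z S) hG.1 n (by omega)
            rwa [sub_sub_sub_cancel_right, map_sub, sub_eq_zero] at this
          · by_cases hne : n ∈ Set.range e
            · obtain ⟨p, rfl⟩ := hne
              have hpS : p ∈ S := hS (by simp)
              rw [coeff_expProd ord he hinj z hpS, expProd_trunc ord he hfin z (hmono.trans hS),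
                hzp p, add_sub_cancel]
            · rw [coeff_expProd_of_notMem ord he z S h0 hne,
                expProd_trunc ord he hfin z (hmono.trans hS)]
              have := hlead n rfl h0
              rw [hI n h0 hne, Submodule.mem_bot, sub_eq_zero] at this
              exact this.symm
  exact ⟨z, fun p => (key _).1 p (Nat.lt_succ_self _), fun K => (key K).2⟩

end factorization

end Series

namespace Series

open MvPowerSeries

/-! ### Evaluation of operator-valued series on the completion -/

variable {σ : Type*}

/-- The value of the monomial with exponent `n`. -/
def monom (u : σ → ℂ) (n : σ →₀ ℕ) : ℂ := n.prod fun i k => u i ^ k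

theorem monom_zero (u : σ → ℂ) : monom u 0 = 1 := Finsupp.prod_zero_index

theorem monom_add (u : σ → ℂ) (m n : σ →₀ ℕ) : monom u (m + n) = monom u m * monom u n := by
  classical
  exact Finsupp.prod_add_index' (fun _ => pow_zero _) fun _ _ _ => pow_add _ _ _

/-- A polynomial with coefficients in a vector space that vanishes everywhere is zero. -/
theorem eq_zero_of_forall_sum_monom {V : Type*} [AddCommGroup V] [Module ℂ V]
    {s : Finset (σ →₀ ℕ)} {c : (σ →₀ ℕ) → V} (hc : ∀ u, ∑ n ∈ s, monom u n • c n = 0)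
    {n : σ →₀ ℕ} (hn : n ∈ s) : c n = 0 := by
  classical
  -- Linear functionals reduce the claim to scalar polynomials over the infinite field `ℂ`.
  rw [← forall_dual_apply_eq_zero_iff ℂ]
  intro φ
  have hp : ∑ n ∈ s, MvPolynomial.monomial n (φ (c n)) = 0 := by
    refine MvPolynomial.funext fun u => ?_
    rw [map_sum, map_zero, ← φ.map_zero, ← hc u, map_sum]
    refine Finset.sum_congr rfl fun n _ => ?_
    rw [MvPolynomial.eval_monomial, map_smul, smul_eq_mul, mul_comm]
    rfl
  have := congrArg (MvPolynomial.coeff n) hp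
  rw [MvPolynomial.coeff_sum, MvPolynomial.coeff_zero, Finset.sum_eq_single n] at this
  · simpa using this
  · intro m _ hm
    rw [MvPolynomial.coeff_monomial, if_neg hm]
  · exact fun h => absurd hn h

end Series

namespace StandardGrading

open MvPowerSeries Series

variable {ι : Type*} [Fintype ι] [DecidableEq ι] {A : Matrix ι ι ℤ}
  {H : Type*} [AddCommGroup H] [Module ℂ H] {R : Realization A H}
  {L : WeightLattice R} {V : Type*} [AddCommGroup V] [Module ℂ V]
  [LieRingModule (Alg R) V] [LieModule ℂ (Alg R) V] {F : StandardGrading L V}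
  {σ : Type*} {w : (σ →₀ ℕ) →+ ℕ} (hw : ∀ K, {n | w n < K}.Finite)

/-- `T` is the value at `u` of the series `G`, whose term of exponent `n` has degree `w n`. -/
def Represents (hw : ∀ K, {n | w n < K}.Finite) (u : σ → ℂ) (T : End ℂ F.Hat)
    (G : MvPowerSeries σ (End ℂ V)) : Prop :=
  ∀ N v, F.OrdGE N v → ∀ (m : ℤ) (K : ℕ), m < N + K →
    (T v).1 m = ∑ n ∈ (hw K).toFinset, monom u n • (coeff n G) (v.1 (m - w n))

variable {hw} {u : σ → ℂ} {T T' : End ℂ F.Hat} {G G' : MvPowerSeries σ (End ℂ V)}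

theorem Represents.ordGE (h : Represents hw u T G) {N : ℤ} {v : F.Hat} (hv : F.OrdGE N v) :
    F.OrdGE N (T v) := by
  intro m hm
  rw [h N v hv m 0 (by simpa using hm)]
  exact Finset.sum_eq_zero fun n hn => by simp at hn

theorem Represents.monomial {p : σ →₀ ℕ} {k : ℤ} (hk : k = w p) {x : F.gPart k} {z : Alg R}
    (hz : (x : Alg R) = monom u p • z) :
    Represents hw u (F.rhoHat k x) (monomial p (LieModule.toEnd ℂ (Alg R) V z)) := by
  classical
  intro N v hv m K hm
  change ⁅(x : Alg R), v.1 (m - k)⁆ = _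
  rw [Finset.sum_eq_single p]
  · rw [coeff_monomial, if_pos rfl, hz, hk, smul_lie]
    rfl
  · intro n _ hn
    rw [coeff_monomial, if_neg hn, LinearMap.zero_apply, smul_zero]
  · intro hp
    have hp' : ¬ w p < K := by simpa using hp
    rw [hv (m - w p) (by omega), map_zero, smul_zero]

theorem represents_one : Represents hw u (1 : End ℂ F.Hat) 1 := by
  classical
  intro N v hv m K hm
  by_cases hK : 0 < K
  · rw [Finset.sum_eq_single 0]
    · simp [monom_zero]
    · intro n _ hn
      rw [coeff_one, if_neg hn, LinearMap.zero_apply, smul_zero]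
    · intro h0
      simp [hK] at h0
  · obtain rfl : K = 0 := by omega
    rw [Module.End.one_apply, hv m (by simpa using hm)]
    exact (Finset.sum_eq_zero fun n hn => by simp at hn).symm

/-- Monomials multiply and degree shifts add. Terms of total weight at least `K` see a component of
`v` below `N`, which is zero. -/
theorem Represents.mul (h : Represents hw u T G) (h' : Represents hw u T' G') :
    Represents hw u (T * T') (G * G') := by
  classical
  intro N v hv m K hm
  have e1 : ((T * T') v).1 m = ∑ i ∈ (hw K).toFinset, ∑ j ∈ (hw K).toFinset,
      monom u (i + j) • (coeff i G * coeff j G') (v.1 (m - w (i + j))) := by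
    rw [Module.End.mul_apply, h N (T' v) (h'.ordGE hv) m K hm]
    refine Finset.sum_congr rfl fun i _ => ?_
    rw [h' N v hv (m - w i) K (by omega), map_sum, Finset.smul_sum]
    refine Finset.sum_congr rfl fun j _ => ?_
    rw [map_smul, smul_smul, ← monom_add, Module.End.mul_apply, map_add, Nat.cast_add, sub_sub]
  rw [e1, ← sum_antidiagonal_eq_sum_sum w K (hw K).toFinset (by simp)
    (fun i j => monom u (i + j) • (coeff i G * coeff j G') (v.1 (m - w (i + j))))]
  · refine Finset.sum_congr rfl fun k _ => ?_
    rw [coeff_mul, LinearMap.sum_apply, Finset.smul_sum]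
    refine Finset.sum_congr rfl fun p hp => ?_
    rw [Finset.HasAntidiagonal.mem_antidiagonal.1 hp]
  · intro i j hij
    rw [hv _ (by omega), map_zero, smul_zero]

theorem Represents.neg (h : Represents hw u T G) : Represents hw u (-T) (-G) := by
  intro N v hv m K hm
  change -((T v).1 m) = _
  rw [h N v hv m K hm, ← Finset.sum_neg_distrib]
  refine Finset.sum_congr rfl fun n _ => ?_
  rw [map_neg, LinearMap.neg_apply, smul_neg]

theorem Represents.pow (h : Represents hw u T G) (k : ℕ) : Represents hw u (T ^ k) (G ^ k) := by
  induction k with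
  | zero => exact represents_one
  | succ k ih => rw [pow_succ, pow_succ]; exact ih.mul h

/-- The operator exponential may be cut at `K` terms because `T` raises degrees, and the series
exponential because `G` has positive weight. The same `K` serves for both. -/
theorem Represents.exp (h : Represents hw u T G) (hT : F.Raising T) (hG : G ∈ filt (End ℂ V) w 1) :
    Represents hw u (expEnd T hT) (fexp w G) := by
  intro N v hv m K hm
  change expFun T v m = _
  rw [expFun_eq hT hv hm]
  have e1 : ∀ k ∈ Finset.range K, ((k.factorial : ℂ)⁻¹) • (((T ^ k) v).1 m)
      = ∑ n ∈ (hw K).toFinset, monom u n •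
        (((k.factorial : ℂ)⁻¹) • (coeff n (G ^ k)) (v.1 (m - w n))) := by
    intro k _
    rw [h.pow k N v hv m K hm, Finset.smul_sum]
    exact Finset.sum_congr rfl fun n _ => smul_comm _ _ _
  rw [Finset.sum_congr rfl e1, Finset.sum_comm]
  refine Finset.sum_congr rfl fun n hn => ?_
  have hn' : w n < K := by simpa using hn
  have := fexp_sub_mem hG K n hn'
  rw [map_sub, sub_eq_zero, map_sum] at this
  rw [this, LinearMap.sum_apply, Finset.smul_sum]
  rfl

/-- The relation `Represents` is closed under products, so it is carried through the ordered product
of pairs in the product group, whose projections are the two ordered products. -/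
theorem represents_ordProd {J : Type*} (ord : LinearOrder J) {a : J → F.GLHat}
    {b : J → (MvPowerSeries σ (End ℂ V))ˣ}
    (hab : ∀ p, Represents hw u (a p : End ℂ F.Hat) (b p : MvPowerSeries σ (End ℂ V)))
    (S : Finset J) : Represents hw u (F.finProd ord a S : End ℂ F.Hat)
 (ordProd ord b S).1 := by
  have h := ordProd_mem ord (fun c : F.GLHat × (MvPowerSeries σ (End ℂ V))ˣ =>
    Represents hw u (c.1 : End ℂ F.Hat) (c.2 : MvPowerSeries σ (End ℂ V))) represents_one
    (fun _ _ ha hb => ha.mul hb) (a := fun p => (a p, b p)) hab S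
  have h1 := map_ordProd (MonoidHom.fst F.GLHat (MvPowerSeries σ (End ℂ V))ˣ) ord
    (fun p => (a p, b p)) S
  have h2 := map_ordProd (MonoidHom.snd F.GLHat (MvPowerSeries σ (End ℂ V))ˣ) ord
    (fun p => (a p, b p)) S
  simp only [MonoidHom.coe_fst, MonoidHom.coe_snd] at h1 h2
  rw [h1, h2] at h
  exact h

/-- The series of `exp(ρ(z) t ^ p)`. -/
def expSeries (V : Type*) [AddCommGroup V] [Module ℂ V] [LieRingModule (Alg R) V]
    [LieModule ℂ (Alg R) V] {p : σ →₀ ℕ} (hp : 0 < w p) (z : Alg R) :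
    (MvPowerSeries σ (End ℂ V))ˣ :=
  fexpU (MvPowerSeries.monomial p (LieModule.toEnd ℂ (Alg R) V z)) (monomial_mem_filt_one hp _)

theorem represents_expRho {k : ℤ} (hk : 0 < k) {p : σ →₀ ℕ} (hp : 0 < w p) (hkp : k = w p)
    {x : F.gPart k} {z : Alg R} (hz : (x : Alg R) = monom u p • z) :
    Represents hw u (F.expRho hk x : End ℂ F.Hat)
      (expSeries V hp z : MvPowerSeries σ (End ℂ V)) :=
  (Represents.monomial hkp hz).exp (F.rhoHat_raising hk x) (monomial_mem_filt_one hp _)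

theorem represents_expRho_inv {k : ℤ} (hk : 0 < k) {p : σ →₀ ℕ} (hp : 0 < w p) (hkp : k = w p)
    {x : F.gPart k} {z : Alg R} (hz : (x : Alg R) = monom u p • z) :
    Represents hw u ((F.expRho hk x)⁻¹ : F.GLHat).1
      ((expSeries V hp z)⁻¹ : (MvPowerSeries σ (End ℂ V))ˣ).1 :=
  (Represents.monomial hkp hz).neg.exp (F.rhoHat_raising hk x).neg (neg_mem (monomial_mem_filt_one hp _))

/-- The ordered product is determined by the coefficients of the series. -/
theorem isOrderedProd_of_represents {J : Type*} (ord : LinearOrder J) {a : J → F.GLHat}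
    {b : Finset J → MvPowerSeries σ (End ℂ V)}
    (hab : ∀ S, Represents hw u (F.finProd ord a S : End ℂ F.Hat) (b S)) {g : F.GLHat}
    (hg : Represents hw u (g : End ℂ F.Hat) G) (t : ℕ → Finset J)
    (hb : ∀ K n, w n < K → ∀ S, t K ⊆ S → coeff n (b S) = coeff n G) :
    F.IsOrderedProd ord a g := by
  intro v m
  obtain ⟨N, hN⟩ := v.2.2
  have hm : m < N + ((m - N + 1).toNat : ℤ) := by omega
  filter_upwards [Filter.eventually_ge_atTop (t (m - N + 1).toNat)] with S hS
  refine (hab S N v hN m _ hm).trans ((hg N v hN m _ hm).trans ?_).symm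
  refine Finset.sum_congr rfl fun n hn => ?_
  rw [hb (m - N + 1).toNat n (by simpa using hn) S hS]

/-- An element of `V_k` as an element of `V̂`. -/
def single {k : ℤ} {x : V} (hx : x ∈ F.vPart k) : F.Hat :=
  ⟨fun m => if m = k then x else 0, by
    refine ⟨fun m => ?_, k, fun m hm => if_neg hm.ne⟩
    dsimp only
    split_ifs with h
    · rwa [h]
    · exact zero_mem _⟩

theorem iSup_vPart (hV : IsWeightModule R V) (F : StandardGrading L V) :
    ⨆ m, F.vPart m = ⊤ := by
  classical
  rw [eq_top_iff, ← hV.diagonalizable.submodule_iSup_eq_top]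
  refine iSup_le fun μ => ?_
  by_cases hμ : weightSpace R V μ = ⊥
  · rw [hμ]
    exact bot_le
  · refine le_trans ?_ (le_iSup _ (F.f ⟨μ, F.wts_subset μ hμ⟩))
    exact le_iSup₂_of_le (f := fun (μ : L.P) (_ : μ ∈ wtsAt L F.f V (F.f _)) =>
      weightSpace R V (μ : Dual ℂ H)) ⟨μ, F.wts_subset μ hμ⟩ ⟨hμ, rfl⟩ le_rfl

/-- A series is determined by its values. -/
theorem coeff_eq_of_forall_sum_eq (hV : IsWeightModule R V) (F : StandardGrading L V)
    {G G' : MvPowerSeries σ (End ℂ V)} {K : ℕ}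
    (hG : ∀ u N (v : F.Hat), F.OrdGE N v → ∀ m : ℤ, m < N + K →
      ∑ n ∈ (hw K).toFinset, monom u n • (coeff n G) (v.1 (m - w n))
        = ∑ n ∈ (hw K).toFinset, monom u n • (coeff n G') (v.1 (m - w n)))
    {n : σ →₀ ℕ} (hn : w n < K) : coeff n G = coeff n G' := by
  rw [← LinearMap.eqLocus_eq_top, ← top_le_iff, ← iSup_vPart hV F, iSup_le_iff]
  intro k x hx
  -- A vector concentrated in degree `k` is tested in degree `k + w n`. Only exponents of weight `w
  -- n` contribute, and the polynomial identity in `u` separates these from each other.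
  have h0 := eq_zero_of_forall_sum_monom (s := (hw K).toFinset)
    (c := fun i => (coeff i G - coeff i G') ((single hx).1 (k + w n - w i))) (n := n) (by
      intro u
      rw [← sub_eq_zero.2 (hG u k (single hx) (fun m hm => if_neg hm.ne) (k + w n) (by omega)),
        ← Finset.sum_sub_distrib]
      exact Finset.sum_congr rfl fun i _ => by rw [LinearMap.sub_apply, smul_sub]) (by simpa using hn)
  have h1 : (single hx).1 (k + w n - w n) = x := if_pos (by ring)
  simp only [h1, LinearMap.sub_apply, sub_eq_zero] at h0
  exact h0

end StandardGrading

/-! ### Iterated brackets of two elements -/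

section brackets

variable {𝔤 : Type*} [LieRing 𝔤]

/-- Right-normed brackets with `i` entries `x` and `j` entries `y`. -/
inductive IsBracket (x y : 𝔤) : ℕ → ℕ → 𝔤 → Prop
  | left : IsBracket x y 1 0 x
  | right : IsBracket x y 0 1 y
  | lie_left {i j : ℕ} {a : 𝔤} (ha : IsBracket x y i j a) : IsBracket x y (i + 1) j ⁅x, a⁆
  | lie_right {i j : ℕ} {a : 𝔤} (ha : IsBracket x y i j a) : IsBracket x y i (j + 1) ⁅y, a⁆

variable {x y : 𝔤}

theorem IsBracket.not_zero_zero {i j : ℕ} {a : 𝔤} (h : IsBracket x y i j a) : 0 < i + j := by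
  cases h <;> omega

/-- The innermost bracket of a longer word in `x` alone is `[x, x] = 0`. -/
theorem IsBracket.eq_left {i j : ℕ} {a : 𝔤} (h : IsBracket x y i j a) (hj : j = 0) :
    (i = 1 ∧ a = x) ∨ a = 0 := by
  induction h with
  | left => exact Or.inl ⟨rfl, rfl⟩
  | right => omega
  | lie_left _ ih =>
    rcases ih hj with ⟨_, rfl⟩ | rfl
    · exact Or.inr (lie_self _)
    · exact Or.inr (lie_zero _)
  | lie_right _ _ => omega

theorem IsBracket.eq_right {i j : ℕ} {a : 𝔤} (h : IsBracket x y i j a) (hi : i = 0) :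
    (j = 1 ∧ a = y) ∨ a = 0 := by
  induction h with
  | left => omega
  | right => exact Or.inl ⟨rfl, rfl⟩
  | lie_left _ _ => omega
  | lie_right _ ih =>
    rcases ih hi with ⟨_, rfl⟩ | rfl
    · exact Or.inr (lie_self _)
    · exact Or.inr (lie_zero _)

variable [LieAlgebra ℂ 𝔤]

/-- The span of the brackets with `i` entries `x` and `j` entries `y`. -/
def bracketSpan (x y : 𝔤) (i j : ℕ) : Submodule ℂ 𝔤 := Submodule.span ℂ {a | IsBracket x y i j a}

theorem left_mem_bracketSpan : x ∈ bracketSpan x y 1 0 := Submodule.subset_span IsBracket.left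

theorem right_mem_bracketSpan : y ∈ bracketSpan x y 0 1 := Submodule.subset_span IsBracket.right

theorem lie_left_mem_bracketSpan {i j : ℕ} {b : 𝔤} (hb : b ∈ bracketSpan x y i j) :
    ⁅x, b⁆ ∈ bracketSpan x y (i + 1) j := by
  have h : bracketSpan x y i j ≤ (bracketSpan x y (i + 1) j).comap
      (LieAlgebra.ad ℂ 𝔤 x : 𝔤 →ₗ[ℂ] 𝔤) :=
    Submodule.span_le.2 fun a ha => Submodule.subset_span (IsBracket.lie_left ha)
  exact h hb

theorem lie_right_mem_bracketSpan {i j : ℕ} {b : 𝔤} (hb : b ∈ bracketSpan x y i j) :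
    ⁅y, b⁆ ∈ bracketSpan x y i (j + 1) := by
  have h : bracketSpan x y i j ≤ (bracketSpan x y i (j + 1)).comap
      (LieAlgebra.ad ℂ 𝔤 y : 𝔤 →ₗ[ℂ] 𝔤) :=
    Submodule.span_le.2 fun a ha => Submodule.subset_span (IsBracket.lie_right ha)
  exact h hb

/-- Right-normed brackets span the generated subalgebra: the Jacobi identity `[[x, a], b] = [x, [a,
b]] - [a, [x, b]]` allows induction on the left factor. -/
theorem IsBracket.lie_mem {i j : ℕ} {a : 𝔤} (ha : IsBracket x y i j a) :
    ∀ {k l : ℕ} {b : 𝔤}, b ∈ bracketSpan x y k l → ⁅a, b⁆ ∈ bracketSpan x y (i + k) (j + l) := by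
  induction ha with
  | left =>
    intro k l b hb
    rw [add_comm 1, zero_add]
    exact lie_left_mem_bracketSpan hb
  | right =>
    intro k l b hb
    rw [add_comm 1, zero_add]
    exact lie_right_mem_bracketSpan hb
  | @lie_left i j a _ ih =>
    intro k l b hb
    rw [lie_lie]
    have h1 := lie_left_mem_bracketSpan (ih hb)
    have h2 := ih (lie_left_mem_bracketSpan hb)
    rw [show i + k + 1 = i + 1 + k by ring] at h1
    rw [show i + (k + 1) = i + 1 + k by ring] at h2
    exact sub_mem h1 h2
  | @lie_right i j a _ ih =>
    intro k l b hb
    rw [lie_lie]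
    have h1 := lie_right_mem_bracketSpan (ih hb)
    have h2 := ih (lie_right_mem_bracketSpan hb)
    rw [show j + l + 1 = j + 1 + l by ring] at h1
    rw [show j + (l + 1) = j + 1 + l by ring] at h2
    exact sub_mem h1 h2

theorem lie_mem_bracketSpan {i j k l : ℕ} {a b : 𝔤} (ha : a ∈ bracketSpan x y i j)
    (hb : b ∈ bracketSpan x y k l) : ⁅a, b⁆ ∈ bracketSpan x y (i + k) (j + l) := by
  have h : bracketSpan x y i j ≤ (bracketSpan x y (i + k) (j + l)).comap
      ((LieAlgebra.ad ℂ 𝔤 : 𝔤 →ₗ[ℂ] End ℂ 𝔤).flip b) :=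
    Submodule.span_le.2 fun a ha => IsBracket.lie_mem ha hb
  exact h ha

theorem bracketSpan_zero_right_le (x y : 𝔤) (i : ℕ) : bracketSpan x y i 0 ≤ ℂ ∙ x :=
  Submodule.span_le.2 fun a ha => by
    rcases IsBracket.eq_left ha rfl with ⟨_, rfl⟩ | rfl
    · exact Submodule.mem_span_singleton_self _
    · exact zero_mem _

theorem bracketSpan_zero_left_le (x y : 𝔤) (j : ℕ) : bracketSpan x y 0 j ≤ ℂ ∙ y :=
  Submodule.span_le.2 fun a ha => by
    rcases IsBracket.eq_right ha rfl with ⟨_, rfl⟩ | rfl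
    · exact Submodule.mem_span_singleton_self _
    · exact zero_mem _

theorem lie_eq_zero_of_mem_span_singleton {a b c : 𝔤} (ha : a ∈ ℂ ∙ c) (hb : b ∈ ℂ ∙ c) :
    ⁅a, b⁆ = 0 := by
  obtain ⟨s, rfl⟩ := Submodule.mem_span_singleton.1 ha
  obtain ⟨t, rfl⟩ := Submodule.mem_span_singleton.1 hb
  rw [smul_lie, lie_smul, lie_self, smul_zero, smul_zero]

/-- If the total bidegree lies on a coordinate axis, both factors are multiples of one and the same
generator. -/
theorem lie_eq_zero_of_degenerate {i j k l : ℕ} {a b : 𝔤} (ha : a ∈ bracketSpan x y i j)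
    (hb : b ∈ bracketSpan x y k l) (h : ¬ (0 < i + k ∧ 0 < j + l)) : ⁅a, b⁆ = 0 := by
  by_cases hi : i + k = 0
  · obtain ⟨rfl, rfl⟩ : i = 0 ∧ k = 0 := by omega
    exact lie_eq_zero_of_mem_span_singleton (bracketSpan_zero_left_le x y j ha)
      (bracketSpan_zero_left_le x y l hb)
  · obtain ⟨rfl, rfl⟩ : j = 0 ∧ l = 0 := by omega
    exact lie_eq_zero_of_mem_span_singleton (bracketSpan_zero_right_le x y i ha)
      (bracketSpan_zero_right_le x y k hb)

end brackets

/-! ### Brackets of root vectors -/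

section roots

variable {ι : Type*} [Fintype ι] {A : Matrix ι ι ℤ}
  {H : Type*} [AddCommGroup H] [Module ℂ H] {R : Realization A H} {α β : Dual ℂ H}

theorem lie_mem_rootSpace {γ μ : Dual ℂ H} {x y : Alg R} (hx : x ∈ rootSpace R γ)
    (hy : y ∈ rootSpace R μ) : ⁅x, y⁆ ∈ rootSpace R (γ + μ) := by
  intro h
  rw [leibniz_lie, hx h, hy h, smul_lie, lie_smul, LinearMap.add_apply, add_smul]

theorem IsBracket.mem_rootSpace {x y : Alg R} (hx : x ∈ rootSpace R α) (hy : y ∈ rootSpace R β)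
    {i j : ℕ} {a : Alg R} (ha : IsBracket x y i j a) : a ∈ rootSpace R (i • α + j • β) := by
  induction ha with
  | left => simpa using hx
  | right => simpa using hy
  | @lie_left i j a _ ih =>
    have := lie_mem_rootSpace hx ih
    rwa [show α + (i • α + j • β) = (i + 1) • α + j • β by rw [succ_nsmul]; abel] at this
  | @lie_right i j a _ ih =>
    have := lie_mem_rootSpace hy ih
    rwa [show β + (i • α + j • β) = i • α + (j + 1) • β by rw [succ_nsmul]; abel] at this

theorem bracketSpan_le_rootSpace {x y : Alg R} (hx : x ∈ rootSpace R α) (hy : y ∈ rootSpace R β)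
    (i j : ℕ) : bracketSpan x y i j ≤ rootSpace R (i • α + j • β) :=
  Submodule.span_le.2 fun _ ha => IsBracket.mem_rootSpace hx hy ha

/-- All inner brackets of a nonzero right-normed bracket are nonzero, so their weights are roots.
Reading outwards, each step adds `α` or `β`, which is exactly the recursion defining the root span.
-/
theorem IsBracket.mem_rootSpan {x y : Alg R} (hx : x ∈ rootSpace R α) (hy : y ∈ rootSpace R β)
    (hne : ∀ i j : ℕ, 0 < i + j → i • α + j • β ≠ 0) {i j : ℕ} {a : Alg R}
    (ha : IsBracket x y i j a) (h0 : a ≠ 0) (hi : 0 < i) (hj : 0 < j) :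
    i • α + j • β ∈ rootSpan R α β := by
  have hroot : ∀ {i j : ℕ} {a : Alg R}, IsBracket x y i j a → a ≠ 0 →
      i • α + j • β ∈ roots R := fun ha h0 =>
    ⟨hne _ _ ha.not_zero_zero, fun hbot => h0 (by
      have := ha.mem_rootSpace hx hy
      rwa [hbot, Submodule.mem_bot] at this)⟩
  have hstart : ∀ {i j : ℕ} {a : Alg R}, IsBracket x y i j a → a ≠ 0 → i = 1 → j = 1 →
      i • α + j • β ∈ rootSpan R α β := by
    rintro i j a ha h0 rfl rfl
    have h := hroot ha h0
    rw [one_smul, one_smul] at h ⊢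
    exact Set.mem_iUnion.2 ⟨0, rfl, h⟩
  induction ha with
  | left => omega
  | right => omega
  | @lie_left i j a ha ih =>
    have ha0 : a ≠ 0 := fun h => h0 (by rw [h, lie_zero])
    rcases Nat.eq_zero_or_pos i with rfl | hi'
    · rcases ha.eq_right rfl with ⟨rfl, _⟩ | h
      · exact hstart ha.lie_left h0 rfl rfl
      · exact absurd h ha0
    · obtain ⟨n, hn⟩ := Set.mem_iUnion.1 (ih ha0 hi' hj)
      refine Set.mem_iUnion.2 ⟨n + 1, ⟨_, hn, Or.inl ?_⟩, hroot ha.lie_left h0⟩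
      rw [succ_nsmul]
      abel
  | @lie_right i j a ha ih =>
    have ha0 : a ≠ 0 := fun h => h0 (by rw [h, lie_zero])
    rcases Nat.eq_zero_or_pos j with rfl | hj'
    · rcases ha.eq_left rfl with ⟨rfl, _⟩ | h
      · exact hstart ha.lie_right h0 rfl rfl
      · exact absurd h ha0
    · obtain ⟨n, hn⟩ := Set.mem_iUnion.1 (ih ha0 hi hj')
      refine Set.mem_iUnion.2 ⟨n + 1, ⟨_, hn, Or.inr ?_⟩, hroot ha.lie_right h0⟩
      rw [succ_nsmul]
      abel

theorem bracketSpan_eq_bot {x y : Alg R} (hx : x ∈ rootSpace R α) (hy : y ∈ rootSpace R β)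
    (hne : ∀ i j : ℕ, 0 < i + j → i • α + j • β ≠ 0) {i j : ℕ} (hi : 0 < i) (hj : 0 < j)
    (hij : i • α + j • β ∉ rootSpan R α β) : bracketSpan x y i j = ⊥ := by
  rw [bracketSpan, Submodule.span_eq_bot]
  intro a ha
  by_contra h0
  exact hij (IsBracket.mem_rootSpan hx hy hne ha h0 hi hj)

end roots

/-! ### Operators given by Lie algebra elements -/

namespace Series

open MvPowerSeries

variable {σ 𝔤 V : Type*} [LieRing 𝔤] [LieAlgebra ℂ 𝔤] [AddCommGroup V] [Module ℂ V]
  [LieRingModule 𝔤 V] [LieModule ℂ 𝔤 V]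

theorem toEnd_lie_eq (a b : 𝔤) : LieModule.toEnd ℂ 𝔤 V ⁅a, b⁆
    = LieModule.toEnd ℂ 𝔤 V a * LieModule.toEnd ℂ 𝔤 V b
      - LieModule.toEnd ℂ 𝔤 V b * LieModule.toEnd ℂ 𝔤 V a :=
  LinearMap.ext fun v => lie_lie a b v

theorem isLiePair_map {M I : (σ →₀ ℕ) → Submodule ℂ 𝔤} (hIM : ∀ n, I n ≤ M n)
    (h : ∀ p q, ∀ a ∈ M p, ∀ b ∈ M q, ⁅a, b⁆ ∈ I (p + q)) :
    IsLiePair (fun n => (M n).map (LieModule.toEnd ℂ 𝔤 V : 𝔤 →ₗ[ℂ] End ℂ V))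
      (fun n => (I n).map (LieModule.toEnd ℂ 𝔤 V : 𝔤 →ₗ[ℂ] End ℂ V)) where
  le n := Submodule.map_mono (hIM n)
  lie_mem := by
    rintro p q _ ⟨a, ha, rfl⟩ _ ⟨b, hb, rfl⟩
    refine ⟨⁅a, b⁆, h p q a ha b hb, ?_⟩
    exact toEnd_lie_eq a b

theorem coeff_fexp_monomial_eq_zero {B : Type*} [Ring B] [Algebra ℂ B] {w : (σ →₀ ℕ) →+ ℕ}
    {p n : σ →₀ ℕ} (z : B) {s : σ} (hp : p s = 0) (hn : n s ≠ 0) :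
    coeff n (fexp w (monomial p z)) = 0 := by
  classical
  have hpow : ∀ (k : ℕ) (n : σ →₀ ℕ), n s ≠ 0 → coeff n (monomial p z ^ k) = 0 := by
    intro k
    induction k with
    | zero =>
      intro n hn
      rw [pow_zero, coeff_one, if_neg]
      rintro rfl
      exact hn rfl
    | succ k ih =>
      intro n hn
      rw [pow_succ', coeff_monomial_mul]
      split_ifs
      · rw [ih (n - p) (by rw [Finsupp.tsub_apply, hp]; exact hn), mul_zero]
      · rfl
  rw [fexp, coeff_ssum]
  refine Finset.sum_eq_zero fun k _ => ?_
  change (k.factorial : ℂ)⁻¹ • coeff n (monomial p z ^ k) = 0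
  rw [hpow k n hn, smul_zero]

theorem coeff_fexp_monomial_self {B : Type*} [Ring B] [Algebra ℂ B] {w : (σ →₀ ℕ) →+ ℕ}
    {p : σ →₀ ℕ} (hp : 0 < w p) (z : B) : coeff p (fexp w (monomial p z)) = z := by
  classical
  have h := fexp_sub_one_mem hp (monomial_mem_filt (w := w) p z) p (Nat.lt_succ_self _)
  have hp0 : p ≠ 0 := by
    rintro rfl
    simp at hp
  rw [map_sub, map_sub, coeff_one, if_neg hp0, sub_zero, coeff_monomial, if_pos rfl,
    sub_eq_zero] at h
  exact h

end Series

namespace StandardGrading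

open MvPowerSeries Series

variable {ι : Type*} [Fintype ι] [DecidableEq ι] {A : Matrix ι ι ℤ}
  {H : Type*} [AddCommGroup H] [Module ℂ H] {R : Realization A H}
  {L : WeightLattice R} {V : Type*} [AddCommGroup V] [Module ℂ V]
  [LieRingModule (Alg R) V] [LieModule ℂ (Alg R) V] {F : StandardGrading L V}
  {α β : Dual ℂ H}

omit [DecidableEq ι] in
theorem expSeries_mem_lieGroup {σ : Type*} {w : (σ →₀ ℕ) →+ ℕ}
    {M : (σ →₀ ℕ) → Submodule ℂ (Alg R)} {I : (σ →₀ ℕ) → Submodule ℂ (End ℂ V)}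
    (h : IsLiePair
      (fun n => (M n).map (LieModule.toEnd ℂ (Alg R) V : Alg R →ₗ[ℂ] End ℂ V)) I)
    {p : σ →₀ ℕ} (hp : 0 < w p) {z : Alg R} (hz : z ∈ M p) :
    expSeries V hp z ∈ lieGroup w h
      (fun n => (M n).map (LieModule.toEnd ℂ (Alg R) V : Alg R →ₗ[ℂ] End ℂ V)) h.le
      (fun _ => le_rfl) :=
  fexpU_mem_lieGroup (D := fun n => (M n).map
    (LieModule.toEnd ℂ (Alg R) V : Alg R →ₗ[ℂ] End ℂ V)) (Submodule.mem_map_of_mem hz) _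

/-! ### Bidegrees -/

/-- The exponent `(i, j)`. -/
def expo (i j : ℕ) : Fin 2 →₀ ℕ := Finsupp.single 0 i + Finsupp.single 1 j

@[simp] theorem expo_zero (i j : ℕ) : expo i j 0 = i := by simp [expo]

@[simp] theorem expo_one (i j : ℕ) : expo i j 1 = j := by simp [expo]

theorem expo_eta (n : Fin 2 →₀ ℕ) : expo (n 0) (n 1) = n := by
  ext k
  fin_cases k <;> simp

theorem monom_expo (u : Fin 2 → ℂ) (i j : ℕ) : monom u (expo i j) = u 0 ^ i * u 1 ^ j := by
  rw [monom, Finsupp.prod_fintype _ _ fun _ => pow_zero _, Fin.prod_univ_two, expo_zero, expo_one]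

/-- The weight `(i, j) ↦ i a + j b`. -/
def biweight (a b : ℕ) : (Fin 2 →₀ ℕ) →+ ℕ :=
  a • Finsupp.applyAddHom 0 + b • Finsupp.applyAddHom 1

theorem biweight_apply (a b : ℕ) (n : Fin 2 →₀ ℕ) : biweight a b n = a * n 0 + b * n 1 := rfl

theorem finite_biweight_lt {a b : ℕ} (ha : 0 < a) (hb : 0 < b) (K : ℕ) :
    {n | biweight a b n < K}.Finite := by
  refine (Set.finite_Iic (expo K K)).subset fun n (hn : biweight a b n < K) => ?_
  rw [biweight_apply] at hn
  have h0 : n 0 ≤ a * n 0 := Nat.le_mul_of_pos_left _ ha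
  have h1 : n 1 ≤ b * n 1 := Nat.le_mul_of_pos_left _ hb
  rw [Set.mem_Iic, Finsupp.le_def]
  intro k
  fin_cases k
  · simp only [Fin.zero_eta, expo_zero]
    omega
  · simp only [Fin.mk_one, expo_one]
    omega

/-- The exponent of an index of the commutator formula. -/
def indexExpo (p : CommIndex R α β) : Fin 2 →₀ ℕ := expo p.i p.j

omit [DecidableEq ι] in
theorem indexExpo_injective : Function.Injective (indexExpo : CommIndex R α β → _) := by
  rintro ⟨i, j, _, _, _⟩ ⟨i', j', _, _, _⟩ h
  have h0 : i = i' := by simpa [indexExpo] using DFunLike.congr_fun h 0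
  have h1 : j = j' := by simpa [indexExpo] using DFunLike.congr_fun h 1
  subst h0 h1
  rfl

theorem deg_eq_toNat (F : StandardGrading L V) {γ : Dual ℂ H} (hγ : γ ∈ posRoots R) :
    F.deg hγ = ((F.deg hγ).toNat : ℤ) := (Int.toNat_of_nonneg (F.deg_pos hγ).le).symm

/-- The weight of exponents given by the degrees of `α` and `β`. -/
def degWeight (F : StandardGrading L V) (hα : α ∈ posRoots R) (hβ : β ∈ posRoots R) :
    (Fin 2 →₀ ℕ) →+ ℕ := biweight (F.deg hα).toNat (F.deg hβ).toNat

theorem degWeight_expo (F : StandardGrading L V) (hα : α ∈ posRoots R) (hβ : β ∈ posRoots R)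
    (i j : ℕ) : (F.degWeight hα hβ (expo i j) : ℤ) = i * F.deg hα + j * F.deg hβ := by
  rw [degWeight, biweight_apply, expo_zero, expo_one]
  push_cast
  rw [← F.deg_eq_toNat, ← F.deg_eq_toNat]
  ring

theorem degWeight_pos (F : StandardGrading L V) (hα : α ∈ posRoots R) (hβ : β ∈ posRoots R)
    {i j : ℕ} (hij : 0 < i + j) : 0 < F.degWeight hα hβ (expo i j) := by
  have h := F.degWeight_expo hα hβ i j
  have ha := F.deg_pos hα
  have hb := F.deg_pos hβ
  have : 0 < (F.degWeight hα hβ (expo i j) : ℤ) := by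
    rw [h]
    rcases Nat.eq_zero_or_pos i with rfl | hi
    · have : 0 < j := by omega
      positivity
    · positivity
  exact_mod_cast this

theorem finite_degWeight_lt (F : StandardGrading L V) (hα : α ∈ posRoots R) (hβ : β ∈ posRoots R)
    (K : ℕ) : {n | F.degWeight hα hβ n < K}.Finite :=
  finite_biweight_lt (by have := F.deg_pos hα; omega) (by have := F.deg_pos hβ; omega) K

theorem finite_indexExpo_lt (F : StandardGrading L V) (hα : α ∈ posRoots R) (hβ : β ∈ posRoots R)
    (K : ℕ) : {p : CommIndex R α β | F.degWeight hα hβ (indexExpo p) < K}.Finite :=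
  (F.finite_degWeight_lt hα hβ K).preimage indexExpo_injective.injOn

theorem f_nsmul_add (F : StandardGrading L V) (hα : α ∈ posRoots R) (hβ : β ∈ posRoots R)
    (i j : ℕ) (h : i • α + j • β ∈ L.P) :
    F.f ⟨i • α + j • β, h⟩ = F.degWeight hα hβ (expo i j) := by
  have e : (⟨i • α + j • β, h⟩ : L.P)
      = i • ⟨α, posRoots_mem_lattice L hα⟩ + j • ⟨β, posRoots_mem_lattice L hβ⟩ := rfl
  rw [e, map_add, map_nsmul, map_nsmul, degWeight_expo, nsmul_eq_mul, nsmul_eq_mul]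
  rfl

theorem deg_root (F : StandardGrading L V) (hα : α ∈ posRoots R) (hβ : β ∈ posRoots R)
    (p : CommIndex R α β) :
    F.deg (p.root_mem hα hβ) = F.degWeight hα hβ (indexExpo p) :=
  F.f_nsmul_add hα hβ p.i p.j _

/-- The degree is strictly positive on such combinations. This replaces linear independence of `α`
and `β`, which is not assumed. -/
theorem nsmul_add_ne_zero (F : StandardGrading L V) (hα : α ∈ posRoots R) (hβ : β ∈ posRoots R)
    (i j : ℕ) (hij : 0 < i + j) : i • α + j • β ≠ 0 := by
  intro h0
  have hmem : i • α + j • β ∈ L.P := by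
    rw [h0]
    exact zero_mem _
  have h := F.f_nsmul_add hα hβ i j hmem
  have e : (⟨i • α + j • β, hmem⟩ : L.P) = 0 := Subtype.ext h0
  have := F.degWeight_pos hα hβ hij
  rw [e, map_zero] at h
  omega

/-! ### The graded Lie algebras generated by two root vectors -/

/-- The brackets of `x` and `y`, by bidegree. -/
def bracketFamily (x y : Alg R) (n : Fin 2 →₀ ℕ) : Submodule ℂ (Alg R) :=
  bracketSpan x y (n 0) (n 1)

open Classical in
/-- The brackets that involve both `x` and `y`, by bidegree. -/
def mixedFamily (x y : Alg R) (n : Fin 2 →₀ ℕ) : Submodule ℂ (Alg R) :=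
  if 0 < n 0 ∧ 0 < n 1 then bracketSpan x y (n 0) (n 1) else ⊥

omit [DecidableEq ι] in
-- A bracket of two homogeneous elements either involves both generators or vanishes.
theorem isLiePair_bracket (V : Type*) [AddCommGroup V] [Module ℂ V]
    [LieRingModule (Alg R) V] [LieModule ℂ (Alg R) V] (x y : Alg R) : IsLiePair
      (fun n => (bracketFamily x y n).map (LieModule.toEnd ℂ (Alg R) V : Alg R →ₗ[ℂ] End ℂ V))
      (fun n => (mixedFamily x y n).map (LieModule.toEnd ℂ (Alg R) V : Alg R →ₗ[ℂ] End ℂ V)) := by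
  refine isLiePair_map (fun n => ?_) fun p q a ha b hb => ?_
  · rw [mixedFamily]
    split_ifs
    · exact le_rfl
    · exact bot_le
  · rw [mixedFamily]
    split_ifs with h
    · exact lie_mem_bracketSpan ha hb
    · rw [lie_eq_zero_of_degenerate ha hb h]
      exact zero_mem _

theorem mixedFamily_eq_bot (F : StandardGrading L V) (hα : α ∈ posRoots R) (hβ : β ∈ posRoots R)
    {x y : Alg R} (hx : x ∈ rootSpace R α) (hy : y ∈ rootSpace R β) {n : Fin 2 →₀ ℕ}
    (hn : n ∉ Set.range (indexExpo : CommIndex R α β → _)) : mixedFamily x y n = ⊥ := by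
  rw [mixedFamily]
  split_ifs with h
  · refine bracketSpan_eq_bot hx hy (F.nsmul_add_ne_zero hα hβ) h.1 h.2 fun hmem => hn ?_
    exact ⟨⟨n 0, n 1, h.1, h.2, hmem⟩, expo_eta n⟩
  · rfl

/-! ### The commutator formula in terms of series -/

section formula

variable (F) (hα : α ∈ posRoots R) (hβ : β ∈ posRoots R)

/-- The series of the commutator. -/
def commSeries (x y : Alg R) : (MvPowerSeries (Fin 2) (End ℂ V))ˣ :=
  expSeries V (F.degWeight_pos hα hβ (i := 1) (j := 0) one_pos) x
    * expSeries V (F.degWeight_pos hα hβ (i := 0) (j := 1) one_pos) y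
    * (expSeries V (F.degWeight_pos hα hβ (i := 1) (j := 0) one_pos) x)⁻¹
    * (expSeries V (F.degWeight_pos hα hβ (i := 0) (j := 1) one_pos) y)⁻¹

theorem represents_comm (u : Fin 2 → ℂ) (x : rootSpace R α) (y : rootSpace R β) :
    Represents (F.finite_degWeight_lt hα hβ) u
      (comm (F.expRoot hα (u 0 • x)) (F.expRoot hβ (u 1 • y)) : End ℂ F.Hat)
      (F.commSeries hα hβ x y : MvPowerSeries (Fin 2) (End ℂ V)) := by
  have ha : F.deg hα = F.degWeight hα hβ (expo 1 0) := by rw [degWeight_expo]; simp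
  have hb : F.deg hβ = F.degWeight hα hβ (expo 0 1) := by rw [degWeight_expo]; simp
  have hx : ((u 0 • x : rootSpace R α) : Alg R) = monom u (expo 1 0) • (x : Alg R) := by
    rw [monom_expo]; simp
  have hy : ((u 1 • y : rootSpace R β) : Alg R) = monom u (expo 0 1) • (y : Alg R) := by
    rw [monom_expo]; simp
  exact (((represents_expRho (F.deg_pos hα) _ ha hx).mul
    (represents_expRho (F.deg_pos hβ) _ hb hy)).mul
    (represents_expRho_inv (F.deg_pos hα) _ ha hx)).mul
    (represents_expRho_inv (F.deg_pos hβ) _ hb hy)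

theorem indexExpo_pos (p : CommIndex R α β) : 0 < F.degWeight hα hβ (indexExpo p) :=
  F.degWeight_pos hα hβ (by have := p.i_pos; omega)

theorem represents_finProd (u : Fin 2 → ℂ) (ord : LinearOrder (CommIndex R α β))
    (z : (p : CommIndex R α β) → rootSpace R p.root) (S : Finset (CommIndex R α β)) :
    Represents (F.finite_degWeight_lt hα hβ) u
      (F.finProd ord (fun p => F.expRoot (p.root_mem hα hβ) ((u 0 ^ p.i * u 1 ^ p.j) • z p)) S :
        End ℂ F.Hat)
      (expProd ord (F.indexExpo_pos hα hβ)
        (fun p => LieModule.toEnd ℂ (Alg R) V (z p : Alg R)) S).1 :=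
  represents_ordProd ord (fun p => represents_expRho (F.deg_pos (p.root_mem hα hβ))
    (F.indexExpo_pos hα hβ p) (F.deg_root hα hβ p) (by rw [indexExpo, monom_expo]; rfl)) S

theorem commFormula_of_coeff (ord : LinearOrder (CommIndex R α β)) (x : rootSpace R α)
    (y : rootSpace R β) (z : (p : CommIndex R α β) → rootSpace R p.root)
    (h : ∀ K n, F.degWeight hα hβ n < K → ∀ S, (F.finite_indexExpo_lt hα hβ K).toFinset ⊆ S →
      coeff n (expProd ord (F.indexExpo_pos hα hβ)
        (fun p => LieModule.toEnd ℂ (Alg R) V (z p : Alg R)) S).1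
        = coeff n (F.commSeries hα hβ x y : MvPowerSeries (Fin 2) (End ℂ V))) :
    F.CommFormula hα hβ ord x y z := by
  intro u v
  exact isOrderedProd_of_represents ord (F.represents_finProd hα hβ ![u, v] ord z)
    (F.represents_comm hα hβ ![u, v] x y) _ h

/-- Both products have the same values for all `u`, `v`, hence the same coefficients, and these
determine the factors. -/
theorem toEnd_eq_of_commFormula (hV : IsWeightModule R V) {ord : LinearOrder (CommIndex R α β)}
    {x : rootSpace R α} {y : rootSpace R β} {z z' : (p : CommIndex R α β) → rootSpace R p.root}
    (hz : F.CommFormula hα hβ ord x y z) (hz' : F.CommFormula hα hβ ord x y z')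
    (p : CommIndex R α β) :
    LieModule.toEnd ℂ (Alg R) V (z p : Alg R) = LieModule.toEnd ℂ (Alg R) V (z' p : Alg R) := by
  have h : (fun p => LieModule.toEnd ℂ (Alg R) V (z p : Alg R))
      = fun p => LieModule.toEnd ℂ (Alg R) V (z' p : Alg R) := ?_
  · exact congrFun h p
  refine expProd_injective ord (F.indexExpo_pos hα hβ) (F.finite_indexExpo_lt hα hβ)
    indexExpo_injective fun K n hn => ?_
  refine coeff_eq_of_forall_sum_eq (hw := F.finite_degWeight_lt hα hβ) hV F (K := K) ?_ hn
  intro u N v hv m hm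
  -- `S` contains all indices of weight below `K` and is so large that both products have reached
  -- their limit in the given component.
  obtain ⟨S, hS, h1, h2⟩ := ((Filter.eventually_ge_atTop
    (F.finite_indexExpo_lt hα hβ K).toFinset).and
      ((hz (u 0) (u 1) v m).and (hz' (u 0) (u 1) v m))).exists
  have h3 := (F.represents_finProd hα hβ u ord z S N v hv m K hm).symm.trans
    ((h1.trans h2.symm).trans (F.represents_finProd hα hβ u ord z' S N v hv m K hm))
  convert h3 using 2 with i hi i hi
  · rw [coeff_expProd_stable ord _ (F.finite_indexExpo_lt hα hβ) _ hS (by simpa using hi)]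
  · rw [coeff_expProd_stable ord _ (F.finite_indexExpo_lt hα hβ) _ hS (by simpa using hi)]

theorem commSeries_mem (x y : Alg R) :
    F.commSeries hα hβ x y ∈ lieGroup (F.degWeight hα hβ) (isLiePair_bracket V x y)
      (fun n => (mixedFamily x y n).map (LieModule.toEnd ℂ (Alg R) V : Alg R →ₗ[ℂ] End ℂ V))
      (fun _ => le_rfl) (isLiePair_bracket V x y).le := by
  refine commutator_mem_lieGroup (expSeries_mem_lieGroup _ _ ?_) (expSeries_mem_lieGroup _ _ ?_)
  · rw [bracketFamily, expo_zero, expo_one]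
    exact left_mem_bracketSpan
  · rw [bracketFamily, expo_zero, expo_one]
    exact right_mem_bracketSpan

/-- The coefficient of bidegree `(1, 1)` of a product of series in one variable each. -/
theorem coeff_mul_expo_one_one {G G' : MvPowerSeries (Fin 2) (End ℂ V)}
    (h : ∀ n : Fin 2 →₀ ℕ, n 1 ≠ 0 → coeff n G = 0)
    (h' : ∀ n : Fin 2 →₀ ℕ, n 0 ≠ 0 → coeff n G' = 0) :
    coeff (expo 1 1) (G * G') = coeff (expo 1 0) G * coeff (expo 0 1) G' ∧
      coeff (expo 1 1) (G' * G) = coeff (expo 0 1) G' * coeff (expo 1 0) G := by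
  have e1 : expo 1 0 + expo 0 1 = expo 1 1 := by ext k; fin_cases k <;> simp
  have e2 : expo 0 1 + expo 1 0 = expo 1 1 := by rw [add_comm, e1]
  constructor
  · rw [coeff_mul, Finset.sum_eq_single (expo 1 0, expo 0 1)]
    · rintro ⟨p, q⟩ hp hne
      rw [Finset.HasAntidiagonal.mem_antidiagonal] at hp
      by_cases hp1 : p 1 = 0
      · by_cases hq0 : q 0 = 0
        · have h0 := DFunLike.congr_fun hp 0
          have h1 := DFunLike.congr_fun hp 1
          simp only [Finsupp.add_apply, expo_zero, expo_one] at h0 h1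
          refine absurd (Prod.ext ?_ ?_) hne
          · rw [← expo_eta p, hp1, show p 0 = 1 by omega]
          · rw [← expo_eta q, hq0, show q 1 = 1 by omega]
        · rw [h' q hq0, mul_zero]
      · rw [h p hp1, zero_mul]
    · exact fun hn => absurd (Finset.HasAntidiagonal.mem_antidiagonal.2 e1) hn
  · rw [coeff_mul, Finset.sum_eq_single (expo 0 1, expo 1 0)]
    · rintro ⟨q, p⟩ hp hne
      rw [Finset.HasAntidiagonal.mem_antidiagonal] at hp
      by_cases hp1 : p 1 = 0
      · by_cases hq0 : q 0 = 0
        · have h0 := DFunLike.congr_fun hp 0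
          have h1 := DFunLike.congr_fun hp 1
          simp only [Finsupp.add_apply, expo_zero, expo_one] at h0 h1
          refine absurd (Prod.ext ?_ ?_) hne
          · rw [← expo_eta q, hq0, show q 1 = 1 by omega]
          · rw [← expo_eta p, hp1, show p 0 = 1 by omega]
        · rw [h' q hq0, zero_mul]
      · rw [h p hp1, mul_zero]
    · exact fun hn => absurd (Finset.HasAntidiagonal.mem_antidiagonal.2 e2) hn

/-- The commutator series has no terms of low weight, and its leading term is `[x, y]`. -/
theorem coeff_commSeries (x y : Alg R)
    (h : (F.commSeries hα hβ x y : MvPowerSeries (Fin 2) (End ℂ V)) - 1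
      ∈ filt (End ℂ V) (F.degWeight hα hβ) (F.degWeight hα hβ (expo 1 1))) :
    coeff (expo 1 1) (F.commSeries hα hβ x y : MvPowerSeries (Fin 2) (End ℂ V))
      = LieModule.toEnd ℂ (Alg R) V ⁅x, y⁆ := by
  set a := expSeries V (F.degWeight_pos hα hβ (i := 1) (j := 0) one_pos) x with ha
  set b := expSeries V (F.degWeight_pos hα hβ (i := 0) (j := 1) one_pos) y with hb
  set g := F.commSeries hα hβ x y with hg
  have e : g * (b * a) = a * b := by
    rw [hg, commSeries, ← ha, ← hb]
    group
  have h1 : ((b * a : (MvPowerSeries (Fin 2) (End ℂ V))ˣ) : MvPowerSeries (Fin 2) (End ℂ V)) - 1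
      ∈ filt (End ℂ V) (F.degWeight hα hβ) 1 :=
    mul_sub_one_mem
      (fexp_sub_one_mem' one_pos (monomial_mem_filt_one (F.degWeight_pos hα hβ one_pos) _))
      (fexp_sub_one_mem' one_pos (monomial_mem_filt_one (F.degWeight_pos hα hβ one_pos) _))
  -- Since `(g - 1) * (b * a) = a * b - b * a` and `b * a` is `1` to leading order, the `(1, 1)`
  -- coefficient of `g` is that of `a * b - b * a`.
  have h2 := mul_sub_mem_filt h h1 (expo 1 1) (Nat.lt_succ_self _)
  have h3 : coeff (expo 1 1) (1 : MvPowerSeries (Fin 2) (End ℂ V)) = 0 := by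
    classical
    rw [coeff_one, if_neg]
    intro h
    simpa using DFunLike.congr_fun h 0
  rw [sub_mul, one_mul, ← Units.val_mul, e, map_sub, map_sub, map_sub, h3, sub_zero, sub_eq_zero,
    Units.val_mul, Units.val_mul] at h2
  obtain ⟨h4, h5⟩ := coeff_mul_expo_one_one (G := (a : MvPowerSeries (Fin 2) (End ℂ V)))
    (G' := (b : MvPowerSeries (Fin 2) (End ℂ V)))
    (fun n hn => coeff_fexp_monomial_eq_zero _ (s := 1) (by simp) hn)
    (fun n hn => coeff_fexp_monomial_eq_zero _ (s := 0) (by simp) hn)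
  have h6 : coeff (expo 1 0) (a : MvPowerSeries (Fin 2) (End ℂ V))
      = LieModule.toEnd ℂ (Alg R) V x := coeff_fexp_monomial_self (F.degWeight_pos hα hβ one_pos) _
  have h7 : coeff (expo 0 1) (b : MvPowerSeries (Fin 2) (End ℂ V))
      = LieModule.toEnd ℂ (Alg R) V y := coeff_fexp_monomial_self (F.degWeight_pos hα hβ one_pos) _
  rw [← h2, h4, h5, h6, h7, toEnd_lie_eq]

theorem degWeight_one_one_le (p : CommIndex R α β) :
    F.degWeight hα hβ (expo 1 1) ≤ F.degWeight hα hβ (indexExpo p) := by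
  rw [indexExpo, degWeight, biweight_apply, biweight_apply]
  simp only [expo_zero, expo_one]
  exact add_le_add (Nat.mul_le_mul_left _ p.i_pos) (Nat.mul_le_mul_left _ p.j_pos)

theorem exists_commFormula (ord : LinearOrder (CommIndex R α β)) (x : rootSpace R α)
    (y : rootSpace R β) : ∃ z : (p : CommIndex R α β) → rootSpace R p.root,
      F.CommFormula hα hβ ord x y z ∧
      ∀ p, p.i = 1 → p.j = 1 → (z p : Alg R) = ⁅(x : Alg R), (y : Alg R)⁆ := by
  classical
  obtain ⟨ζ, hζ, hprod⟩ := exists_expProd_eq ord (F.indexExpo_pos hα hβ)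
    (F.finite_indexExpo_lt hα hβ) indexExpo_injective
    (F.commSeries_mem hα hβ (x : Alg R) (y : Alg R)) (fun n _ hn => by
      rw [mixedFamily_eq_bot F hα hβ x.2 y.2 hn, Submodule.map_bot])
  have hlow : (F.commSeries hα hβ x y : MvPowerSeries (Fin 2) (End ℂ V)) - 1
      ∈ filt (End ℂ V) (F.degWeight hα hβ) (F.degWeight hα hβ (expo 1 1)) := by
    intro n hn
    rw [map_sub, ← hprod _ n hn _ subset_rfl, sub_eq_zero]
    -- Every index has `i, j ≥ 1`, hence weight at least that of `(1, 1)`. Below this weight the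
    -- product is empty.
    have hempty : (F.finite_indexExpo_lt hα hβ (F.degWeight hα hβ (expo 1 1))).toFinset = ∅ := by
      ext p
      simpa using F.degWeight_one_one_le hα hβ p
    rw [hempty, expProd, ordProd]
    simp
  have h11 : ∀ p : CommIndex R α β, p.i = 1 → p.j = 1 →
      ζ p = LieModule.toEnd ℂ (Alg R) V ⁅(x : Alg R), (y : Alg R)⁆ := by
    intro p hi hj
    have hp : indexExpo p = expo 1 1 := by rw [indexExpo, hi, hj]
    rw [← F.coeff_commSeries hα hβ _ _ hlow, ← hp, ← hprod _ _ (Nat.lt_succ_self _) _ subset_rfl,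
      coeff_expProd ord _ indexExpo_injective ζ (p := p) (by simp)]
    have htr : Series.trunc (F.degWeight hα hβ) indexExpo ζ (F.degWeight hα hβ (indexExpo p)) = 0 := by
      funext q
      rw [Series.trunc, if_neg]
      · rfl
      · rw [hp]
        exact (F.degWeight_one_one_le hα hβ q).not_gt
    have hone : ∀ S, expProd ord (F.indexExpo_pos hα hβ) (0 : CommIndex R α β → End ℂ V) S = 1 := by
      intro S
      refine ordProd_mem ord (fun C : (MvPowerSeries (Fin 2) (End ℂ V))ˣ => C = 1) rfl (fun _ _ ha hb => by rw [ha, hb, one_mul])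
        (fun q => Units.ext ?_) S
      change fexp _ (monomial _ (0 : End ℂ V)) = 1
      rw [map_zero, fexp_zero]
    rw [htr, hone, Units.val_one, coeff_one, if_neg, zero_add]
    intro h0
    rw [hp] at h0
    simpa using DFunLike.congr_fun h0 0
  have hz : ∀ p : CommIndex R α β, ∃ z : rootSpace R p.root,
      LieModule.toEnd ℂ (Alg R) V (z : Alg R) = ζ p ∧
      (p.i = 1 → p.j = 1 → (z : Alg R) = ⁅(x : Alg R), (y : Alg R)⁆) := by
    intro p
    -- The factorization only yields operators, and the representation may have a kernel. At `(1,
    -- 1)` the preimage is therefore chosen to be `[x, y]` itself; elsewhere any preimage in the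
    -- span of brackets will do.
    by_cases hp : p.i = 1 ∧ p.j = 1
    · refine ⟨⟨⁅(x : Alg R), (y : Alg R)⁆, ?_⟩, (h11 p hp.1 hp.2).symm, fun _ _ => rfl⟩
      rw [CommIndex.root, hp.1, hp.2, one_smul, one_smul]
      exact lie_mem_rootSpace x.2 y.2
    · obtain ⟨z, hz, hzζ⟩ := hζ p
      refine ⟨⟨z, ?_⟩, hzζ, fun h1 h2 => absurd ⟨h1, h2⟩ hp⟩
      rw [SetLike.mem_coe, mixedFamily, indexExpo, expo_zero, expo_one,
        if_pos ⟨p.i_pos, p.j_pos⟩] at hz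
      exact bracketSpan_le_rootSpace x.2 y.2 _ _ hz
  choose z hz1 hz2 using hz
  refine ⟨z, F.commFormula_of_coeff hα hβ ord x y z ?_, hz2⟩
  simpa only [hz1] using hprod

end formula

/-! ### The group `Û^+_{V,1}` -/

section singleGrading

theorem lie_mem_gPart (F : StandardGrading L V) {k m : ℤ} {x y : Alg R}
    (hx : x ∈ F.gPart k) (hy : y ∈ F.gPart m) : ⁅x, y⁆ ∈ F.gPart (k + m) := by
  have h1 : ∀ γ ∈ rootsAt L F.f k, ∀ μ ∈ rootsAt L F.f m, ∀ x ∈ rootSpace R (γ : Dual ℂ H),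
      ∀ y ∈ rootSpace R (μ : Dual ℂ H), ⁅x, y⁆ ∈ F.gPart (k + m) := by
    intro γ hγ μ hμ x hx y hy
    have h := lie_mem_rootSpace hx hy
    by_cases hb : rootSpace R ((γ : Dual ℂ H) + (μ : Dual ℂ H)) = ⊥
    · rw [hb, Submodule.mem_bot] at h
      rw [h]
      exact zero_mem _
    · have hmem : γ + μ ∈ rootsAt L F.f (k + m) := by
        refine ⟨?_, by rw [map_add, hγ.2, hμ.2]⟩
        by_cases h0 : γ + μ = 0
        · exact Or.inr h0
        · exact Or.inl ⟨fun h => h0 (Subtype.ext h), hb⟩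
      exact Submodule.mem_iSup_of_mem (γ + μ) (Submodule.mem_iSup_of_mem hmem h)
  have h2 : ∀ γ ∈ rootsAt L F.f k, ∀ x ∈ rootSpace R (γ : Dual ℂ H),
      F.gPart m ≤ (F.gPart (k + m)).comap (LieAlgebra.ad ℂ (Alg R) x : Alg R →ₗ[ℂ] Alg R) := by
    intro γ hγ x hx
    exact iSup₂_le fun μ hμ y hy => h1 γ hγ μ hμ x hx y hy
  have h3 : F.gPart k ≤ (F.gPart (k + m)).comap
      ((LieAlgebra.ad ℂ (Alg R) : Alg R →ₗ[ℂ] End ℂ (Alg R)).flip y) :=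
    iSup₂_le fun γ hγ x hx => h2 γ hγ x hx hy
  exact h3 hx

/-- The weight of the exponents of series in one variable. -/
def uniWeight : (Unit →₀ ℕ) →+ ℕ := Finsupp.applyAddHom ()

@[simp] theorem uniWeight_single (k : ℕ) : uniWeight (Finsupp.single () k) = k := by
  simp [uniWeight]

theorem uniWeight_injective : Function.Injective uniWeight := fun _ _ h =>
  Finsupp.ext fun _ => h

theorem finite_uniWeight_lt (K : ℕ) : {n | uniWeight n < K}.Finite :=
  (Set.finite_Iio K).preimage uniWeight_injective.injOn

/-- The exponent of a positive integer. -/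
def uniExpo (k : ℕ+) : Unit →₀ ℕ := Finsupp.single () (k : ℕ)

theorem uniExpo_injective : Function.Injective uniExpo := fun k l h =>
  PNat.coe_injective (by simpa [uniExpo] using congrArg uniWeight h)

theorem uniExpo_pos (k : ℕ+) : 0 < uniWeight (uniExpo k) := by
  rw [uniExpo, uniWeight_single]
  exact k.pos

theorem finite_uniExpo_lt (K : ℕ) : {k | uniWeight (uniExpo k) < K}.Finite :=
  (finite_uniWeight_lt K).preimage uniExpo_injective.injOn

/-- Here both families coincide: only closure under brackets is needed, since every positive degree
is an admissible index. -/
theorem isLiePair_gPart (F : StandardGrading L V) : IsLiePair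
    (fun n : Unit →₀ ℕ => (F.gPart (uniWeight n : ℤ)).map
      (LieModule.toEnd ℂ (Alg R) V : Alg R →ₗ[ℂ] End ℂ V))
    (fun n : Unit →₀ ℕ => (F.gPart (uniWeight n : ℤ)).map
      (LieModule.toEnd ℂ (Alg R) V : Alg R →ₗ[ℂ] End ℂ V)) :=
  isLiePair_map (fun _ => le_rfl) fun p q a ha b hb => by
    have := F.lie_mem_gPart ha hb
    rwa [← Nat.cast_add, ← map_add] at this

/-- Group commutators of exponentials of homogeneous elements belong to `Û^+_{V,1}`. -/
theorem comm_mem_UHat (F : StandardGrading L V) {k l : ℤ} (hk : 0 < k) (hl : 0 < l)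
    (x : F.gPart k) (y : F.gPart l) : comm (F.expRho hk x) (F.expRho hl y) ∈ F.UHat := by
  have hkw : k = uniWeight (Finsupp.single () k.toNat) := by
    rw [uniWeight_single]
    omega
  have hlw : l = uniWeight (Finsupp.single () l.toNat) := by
    rw [uniWeight_single]
    omega
  have hk' : 0 < uniWeight (Finsupp.single () k.toNat) := by omega
  have hl' : 0 < uniWeight (Finsupp.single () l.toNat) := by omega
  -- The single formal variable records only the degree, so the operators are the values of the
  -- series at `1`.
  have hmon : ∀ n, monom (fun _ : Unit => 1) n = 1 := fun n => by
    simp [monom]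
  have hsmul : ∀ n (z : Alg R), z = monom (fun _ : Unit => 1) n • z := fun n z => by
    rw [hmon, one_smul]
  set a := expSeries V hk' (x : Alg R)
  set b := expSeries V hl' (y : Alg R)
  have hg : a * b * a⁻¹ * b⁻¹ ∈ lieGroup uniWeight F.isLiePair_gPart _ (fun _ => le_rfl)
      F.isLiePair_gPart.le := by
    refine commutator_mem_lieGroup (expSeries_mem_lieGroup F.isLiePair_gPart hk' ?_)
      (expSeries_mem_lieGroup F.isLiePair_gPart hl' ?_)
    · rw [← hkw]
      exact x.2
    · rw [← hlw]
      exact y.2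
  have hrep : Represents finite_uniWeight_lt (fun _ => 1)
      (comm (F.expRho hk x) (F.expRho hl y) : End ℂ F.Hat) (a * b * a⁻¹ * b⁻¹).1 :=
    (((represents_expRho hk _ hkw (hsmul _ _)).mul
      (represents_expRho hl _ hlw (hsmul _ _))).mul
      (represents_expRho_inv hk _ hkw (hsmul _ _))).mul
      (represents_expRho_inv hl _ hlw (hsmul _ _))
  -- Every exponent of positive weight is some `uniExpo k`, so the condition on exponents outside
  -- the index set is vacuous.
  obtain ⟨ζ, hζ, hprod⟩ := exists_expProd_eq (inferInstance : LinearOrder ℕ+) uniExpo_pos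
    finite_uniExpo_lt uniExpo_injective hg (fun n hn hne => absurd ⟨⟨uniWeight n, hn⟩,
      uniWeight_injective (uniWeight_single _)⟩ hne)
  have hz : ∀ k : ℕ+, ∃ z : F.gPart ((k : ℕ) : ℤ),
      LieModule.toEnd ℂ (Alg R) V (z : Alg R) = ζ k := by
    intro k
    obtain ⟨z, hz, hzζ⟩ := hζ k
    refine ⟨⟨z, ?_⟩, hzζ⟩
    rwa [uniExpo, uniWeight_single] at hz
  choose z hz using hz
  have hζz : ζ = fun k => LieModule.toEnd ℂ (Alg R) V (z k : Alg R) := funext fun k => (hz k).symm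
  subst hζz
  refine ⟨z, isOrderedProd_of_represents _ (fun S => represents_ordProd _ (fun k => ?_) S) hrep _
    hprod⟩
  exact represents_expRho _ (uniExpo_pos k) (by rw [uniExpo, uniWeight_single]) (hsmul _ _)

end singleGrading

end StandardGrading

end KM

end

/-! ### The commutator formula -/

theorem mainTheorem9 {ι : Type*} [Fintype ι] [DecidableEq ι] {A : Matrix ι ι ℤ}
    (hA : KM.IsGCM A) (hsymm : KM.IsSymmetrizable A)
    {H : Type*} [AddCommGroup H] [Module ℂ H] (R : KM.Realization A H)
    (L : KM.WeightLattice R)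
    {V : Type*} [AddCommGroup V] [Module ℂ V]
    [LieRingModule (KM.Alg R) V] [LieModule ℂ (KM.Alg R) V]
    (hV : KM.IsWeightModule R V) (F : KM.StandardGrading L V)
    {α β : Module.Dual ℂ H} (hα : α ∈ KM.posRoots R) (hβ : β ∈ KM.posRoots R)
    (x : KM.rootSpace R α) (y : KM.rootSpace R β)
    (ord : LinearOrder (KM.CommIndex R α β)) :
    (∃ z : (p : KM.CommIndex R α β) → KM.rootSpace R p.root,
      F.CommFormula hα hβ ord x y z ∧
      (∀ p, p.i = 1 → p.j = 1 → (z p : KM.Alg R) = ⁅(x : KM.Alg R), (y : KM.Alg R)⁆) ∧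
      (∀ z' : (p : KM.CommIndex R α β) → KM.rootSpace R p.root,
        F.CommFormula hα hβ ord x y z' →
        ∀ p (w : V), ⁅(z' p : KM.Alg R), w⁆ = ⁅(z p : KM.Alg R), w⁆)) ∧
    (KM.StandardGrading.IsPosFaithful R V →
      ∃! z : (p : KM.CommIndex R α β) → KM.rootSpace R p.root,
        F.CommFormula hα hβ ord x y z) ∧
    (∀ u v : ℂ, KM.StandardGrading.comm (F.expRoot hα (u • x)) (F.expRoot hβ (v • y)) ∈ F.UHat) := by
  obtain ⟨z, hz, hz11⟩ := F.exists_commFormula hα hβ ord x y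
  have huniq : ∀ z' : (p : KM.CommIndex R α β) → KM.rootSpace R p.root,
      F.CommFormula hα hβ ord x y z' →
      ∀ p (w : V), ⁅(z' p : KM.Alg R), w⁆ = ⁅(z p : KM.Alg R), w⁆ := fun z' hz' p w =>
    LinearMap.congr_fun (F.toEnd_eq_of_commFormula hα hβ hV hz' hz p) w
  refine ⟨⟨z, hz, hz11, huniq⟩, fun hfaith => ⟨z, hz, fun z' hz' => ?_⟩, fun u v =>
    F.comm_mem_UHat _ _ _ _⟩
  funext p
  refine Subtype.ext (sub_eq_zero.1 ?_)
  -- Faithfulness is applied to the difference of the two candidates, which lies in a single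
  -- positive root space and acts as zero.
  refine hfaith p.root (p.root_mem hα hβ) _ (sub_mem (z' p).2 (z p).2) fun w => ?_
  rw [sub_lie, huniq z' hz' p w, sub_self]
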